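/- **Conventions.** Reflexive graphs are undirected graphs with a loop at every vertex. $C_n$ is the reflexive cycle on $\mathbb Z/n$, $P_\ell$ the reflexive path on $0,\dots,\ell$, and $A\times B$ the categorical product: $(a,b)\sim(a',b')$ iff $a\sim a'$ and $b\sim b'$. The clique complex of a reflexive graph $K$ has as $n$-simplices the ordered $(n+1)$-tuples of pairwise adjacent vertices (repetitions allowed); $C_n(K)$ is the free abelian group on them, $\delta[v_0,\dots,v_n]=\sum_{i=0}^n(-1)^i[v_0,\dots,\widehat{v_i},\dots,v_n]$, and $H_1(K)=\ker\delta_1/\operatorname{im}\delta_2$. A closed walk $(x_0,x_1,\dots,x_m=x_0)$ has the class of $\sum_i[x_i,x_{i+1}]$ in $H_1(K)$; it is a cycle if $m\ge3$ and $x_0,\dots,x_{m-1}$ are distinct. A set of closed walks of $K$ is an *NT-basis* of $K$ if their classes are distinct and form a $\mathbb Z$-basis of $H_1(K)$. **Sum gadget.** Let $g\ge4$, $Z=C_g$, $s\ge2$, $\ell\ge2$ and $B=C_{sg}$. The graph $S_s$ is obtained from $P_\ell\times B$ as follows. (1) For each $0\le j<g$ identify the vertices $(\ell,i+js)$, $0\le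 i<s$; the last slice becomes a copy of $Z$, called $Z$, whose vertex $j$ is the class of $(\ell,js)$. (2) Identify the vertices $(0,ig)$, $0\le i<s$; the first slice becomes $s$ copies $A'_0,\dots,A'_{s-1}$ of $Z$ sharing one vertex, the vertex $j$ of $A_i'$ being $(0,ig+j)$. (3) For each $0\le i<s$ take a new copy of $P_1\times Z$, identify its slice $0\times Z$ with $A'_i$, and call its other slice $A_i$. The *end gadget-cycles* of $S_s$ are $Z$ and the $A_i$; the *gadget-cycles* are the cycles that are a slice $k\times B$ $(0\le k\le\ell)$ or an end gadget-cycle (the last slice being read as the cycle $Z$). $T(S_s)$ is the tree induced in $S_s$ by the vertices $(k,0)$, $0\le k\le\ell$, and the vertex $0$ of each $A_i$. **First-stage graph.** Let $G$ be a finite, nonempty, simple (loopless) graph. Fix $g\ge 4$ and lengths $\ell_2,\ell_3\ge2$, used for all copies of $S_2$ and $S_3$ respectively, and for each edge of $G$ fix the order in which its ends are named. The first-stage graph $\Gamma$ is constructed as follows. (1) Take disjoint copies of $Z=C_g$: $A^v_0,A^v_1,A^v_2$ for each vertex $v$ of $G$, and $Z^*$. (2) For each $v$ take a new copy $S^v$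 of $S_3$; identify its $Z$ with $Z^*$ and its $A_i$ with $A_i^v$ for $i=0,1,2$. (3) For each $v$ and $0\le i<j\le2$ take a new copy $S^v_{i,j}$ of $S_2$; identify its $A_0$ with $A_i^v$ and its $A_1$ with $A_j^v$, the latter by identifying the vertex $k$ of $A_1$ with the vertex $-k \bmod g$ of $A_j^v$. (4) For each edge $uv$ of $G$ and $i=0,1,2$ take a new copy $S_i^{uv}$ of $S_2$; identify its $A_0$ with $A_i^u$ and its $A_1$ with $A_i^v$. All identifications of cycles not otherwise described match equal vertices of $Z$. The (end) gadget-cycles of $\Gamma$ are those of the gadgets used, and $T^*\subseteq\Gamma$ is the union of the trees $T(S)$ of all gadgets $S$ used. **Theorem.** The graph $T^*$ has an NT-basis consisting of cycles. For every NT-basis $\mathcal B_T$ of $T^*$ that consists of cycles: 1. there is a set $\mathcal A$ of gadget-cycles of $\Gamma$ such that $\mathcal A\cup\mathcal B_T$ is an NT-basis of $\Gamma$; 2. if $G^*$ is obtained from $\Gamma$ by adding, for each cycle $C\in\mathcal B_T$, a new vertex $v_C$ adjacent to itself and to every vertex of $C$, then $G^*$ has an NT-basis consisting of end gadget-cycles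 of $\Gamma$. -/

import Mathlib

/-! ## Reflexive graphs -/

/-- A reflexive (undirected) graph: every vertex carries a loop. -/
structure ReflGraph (V : Type*) where
  Adj : V → V → Prop
  symm : ∀ {x y}, Adj x y → Adj y x
  refl : ∀ x, Adj x x

namespace ReflGraph

/-- The reflexive cycle of girth `n`, on the vertices `0, …, n - 1`. -/
def cycle (n : ℕ) : ReflGraph (ZMod n) where
  Adj x y := x = y ∨ y = x + 1 ∨ x = y + 1
  symm := by
    rintro x y (h | h | h)
    · exact Or.inl h.symm
    · exact Or.inr (Or.inr h)
    · exact Or.inr (Or.inl h)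
  refl _ := Or.inl rfl

/-- The reflexive path on the vertices `0, …, l`. -/
def path (l : ℕ) : ReflGraph (Fin (l + 1)) where
  Adj x y := x.val ≤ y.val + 1 ∧ y.val ≤ x.val + 1
  symm h := ⟨h.2, h.1⟩
  refl _ := ⟨Nat.le_succ _, Nat.le_succ _⟩

/-- The categorical product. -/
def prod {V W : Type*} (K : ReflGraph V) (L : ReflGraph W) : ReflGraph (V × W) where
  Adj x y := K.Adj x.1 y.1 ∧ L.Adj x.2 y.2
  symm h := ⟨K.symm h.1, L.symm h.2⟩
  refl _ := ⟨K.refl _, L.refl _⟩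

/-- The disjoint union of two graphs. -/
def sum {V W : Type*} (K : ReflGraph V) (L : ReflGraph W) : ReflGraph (V ⊕ W) where
  Adj x y := (∃ a b, x = Sum.inl a ∧ y = Sum.inl b ∧ K.Adj a b) ∨
    (∃ a b, x = Sum.inr a ∧ y = Sum.inr b ∧ L.Adj a b)
  symm := by
    rintro x y (⟨a, b, ha, hb, h⟩ | ⟨a, b, ha, hb, h⟩)
    · exact Or.inl ⟨b, a, hb, ha, K.symm h⟩
    · exact Or.inr ⟨b, a, hb, ha, L.symm h⟩
  refl := by
    rintro (a | a)
    · exact Or.inl ⟨a, a, rfl, rfl, K.refl a⟩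
    · exact Or.inr ⟨a, a, rfl, rfl, L.refl a⟩

/-- The disjoint union of a family of graphs. -/
def sigma {ι : Type*} {V : ι → Type*} (K : ∀ i, ReflGraph (V i)) : ReflGraph (Σ i, V i) where
  Adj x y := ∃ i a b, x = ⟨i, a⟩ ∧ y = ⟨i, b⟩ ∧ (K i).Adj a b
  symm := by
    rintro x y ⟨i, a, b, ha, hb, h⟩
    exact ⟨i, b, a, hb, ha, (K i).symm h⟩
  refl := by
    rintro ⟨i, a⟩
    exact ⟨i, a, a, rfl, rfl, (K i).refl a⟩

/-- The graph obtained from `K` by identifying vertices that are related by `r`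
(or by the equivalence relation generated by `r`). -/
def quot {V : Type*} (K : ReflGraph V) (r : V → V → Prop) : ReflGraph (Quot r) where
  Adj x y := ∃ a b, Quot.mk r a = x ∧ Quot.mk r b = y ∧ K.Adj a b
  symm := by
    rintro x y ⟨a, b, ha, hb, h⟩
    exact ⟨b, a, hb, ha, K.symm h⟩
  refl := by
    rintro ⟨a⟩
    exact ⟨a, a, rfl, rfl, K.refl a⟩

/-- Graph homomorphisms. -/
structure Hom {V W : Type*} (K : ReflGraph V) (L : ReflGraph W) where
  toFun : V → W
  map_adj : ∀ {x y}, K.Adj x y → L.Adj (toFun x) (toFun y)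

/-! ## Homology of the clique complex -/

/-- The `n`-simplices of the clique complex: ordered `(n+1)`-tuples of pairwise adjacent vertices,
repetitions being allowed as the graph is reflexive. -/
def Simplex {V : Type*} (K : ReflGraph V) (n : ℕ) : Type _ :=
  {v : Fin (n + 1) → V // ∀ i j, K.Adj (v i) (v j)}

/-- The face omitting the `i`-th vertex. -/
def Simplex.face {V : Type*} {K : ReflGraph V} {n : ℕ} (σ : K.Simplex (n + 1)) (i : Fin (n + 2)) :
    K.Simplex n :=
  ⟨fun j => σ.1 (i.succAbove j), fun _ _ => σ.2 _ _⟩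

/-- The chain group, free over `ℤ` on the `n`-simplices. -/
abbrev Chain {V : Type*} (K : ReflGraph V) (n : ℕ) : Type _ := K.Simplex n →₀ ℤ

/-- The boundary map `C_{n+1} → C_n`. -/
noncomputable def boundary {V : Type*} (K : ReflGraph V) (n : ℕ) :
    K.Chain (n + 1) →ₗ[ℤ] K.Chain n :=
  Finsupp.linearCombination ℤ fun σ : K.Simplex (n + 1) =>
    ∑ i : Fin (n + 2), (-1 : ℤ) ^ i.val • Finsupp.single (σ.face i) (1 : ℤ)

/-- The group of `1`-cycles. -/
noncomputable abbrev Z1 {V : Type*} (K : ReflGraph V) : Submodule ℤ (K.Chain 1) :=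
  LinearMap.ker (K.boundary 0)

/-- The first homology group of the clique complex: `1`-cycles modulo boundaries. -/
abbrev H1 {V : Type*} (K : ReflGraph V) : Type _ :=
  K.Z1 ⧸ (LinearMap.range (K.boundary 1)).submoduleOf K.Z1

/-- The `1`-simplex of an edge. -/
def edge {V : Type*} (K : ReflGraph V) {x y : V} (h : K.Adj x y) : K.Simplex 1 :=
  ⟨![x, y], by
    intro i j
    fin_cases i <;> fin_cases j
    · exact K.refl x
    · exact h
    · exact K.symm h
    · exact K.refl y⟩

/-- Closed walks `(x_0, x_1, …, x_{len} = x_0)`. -/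
structure ClosedWalk {V : Type*} (K : ReflGraph V) where
  len : ℕ
  vert : Fin (len + 1) → V
  adj : ∀ i : Fin len, K.Adj (vert i.castSucc) (vert i.succ)
  closed : vert (Fin.last len) = vert 0

namespace ClosedWalk

variable {V W : Type*} {K : ReflGraph V} {L : ReflGraph W}

/-- A closed walk is a cycle (in the sense of graph theory) if it has length at least `3` and does
not repeat a vertex, except that it ends where it starts. -/
def IsCycle (c : K.ClosedWalk) : Prop :=
  3 ≤ c.len ∧ Function.Injective fun i : Fin c.len => c.vert i.castSucc

/-- The vertices of a closed walk. -/
def support (c : K.ClosedWalk) : Set V := Set.range c.vert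

/-- The image of a closed walk under a homomorphism. -/
def map (f : K.Hom L) (c : K.ClosedWalk) : L.ClosedWalk where
  len := c.len
  vert i := f.toFun (c.vert i)
  adj i := f.map_adj (c.adj i)
  closed := congrArg f.toFun c.closed

/-- The `1`-chain `[x_0, x_1] + [x_1, x_2] + ⋯` of a closed walk. -/
noncomputable def chain (c : K.ClosedWalk) : K.Chain 1 :=
  ∑ i : Fin c.len, Finsupp.single (K.edge (c.adj i)) (1 : ℤ)

theorem chain_mem (c : K.ClosedWalk) : c.chain ∈ K.Z1 := by
  let pt : V → K.Chain 0 := fun x => Finsupp.single ⟨fun _ => x, fun _ _ => K.refl x⟩ 1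
  have key : ∀ {x y : V} (h : K.Adj x y),
      K.boundary 0 (Finsupp.single (K.edge h) (1 : ℤ)) = pt y - pt x := by
    intro x y h
    have h0 : (K.edge h).face 0 = ⟨fun _ => y, fun _ _ => K.refl y⟩ := by
      apply Subtype.ext
      funext j
      fin_cases j
      rfl
    have h1 : (K.edge h).face 1 = ⟨fun _ => x, fun _ _ => K.refl x⟩ := by
      apply Subtype.ext
      funext j
      fin_cases j
      rfl
    rw [boundary, Finsupp.linearCombination_single, Fin.sum_univ_two, h0, h1]
    simp [pt, sub_eq_add_neg]
  rw [LinearMap.mem_ker, chain, map_sum]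
  simp only [key]
  rw [Finset.sum_sub_distrib]
  have e1 := Fin.sum_univ_succ fun i : Fin (c.len + 1) => pt (c.vert i)
  have e2 := Fin.sum_univ_castSucc fun i : Fin (c.len + 1) => pt (c.vert i)
  rw [e1, c.closed, add_comm] at e2
  rw [add_right_cancel e2, sub_self]

/-- The homology class of a closed walk. -/
noncomputable def cls (c : K.ClosedWalk) : K.H1 :=
  Submodule.Quotient.mk ⟨c.chain, c.chain_mem⟩

end ClosedWalk

/-- A set of closed walks is an NT-basis if their homology classes form a basis of `H_1`
(different members having different classes). -/
def IsNTBasis {V : Type*} {K : ReflGraph V} (B : Set K.ClosedWalk) : Prop :=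
  LinearIndependent ℤ (fun c : B => c.1.cls) ∧
    Submodule.span ℤ (ClosedWalk.cls '' B) = ⊤

/-- Plugging the members of `B`: for each of them, a new vertex is added that is adjacent to all
of its vertices. -/
def plug {V : Type*} (K : ReflGraph V) (B : Set K.ClosedWalk) : ReflGraph (V ⊕ B) where
  Adj
    | Sum.inl x, Sum.inl y => K.Adj x y
    | Sum.inl x, Sum.inr c => x ∈ c.1.support
    | Sum.inr c, Sum.inl x => x ∈ c.1.support
    | Sum.inr c, Sum.inr d => c = d
  symm := by
    rintro (x | c) (y | d) h
    · exact K.symm h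
    · exact h
    · exact h
    · exact Eq.symm h
  refl := by
    rintro (x | c)
    · exact K.refl x
    · rfl

/-- The inclusion of a graph into the graph with some cycles plugged. -/
def plugIncl {V : Type*} (K : ReflGraph V) (B : Set K.ClosedWalk) : K.Hom (K.plug B) where
  toFun := Sum.inl
  map_adj h := h

end ReflGraph

/-! ## The sum gadget -/

namespace SumGadget

open ReflGraph

/-- The vertices of the disjoint union of `P_l × B`, where `B` is the cycle of girth `s * g`, and of
`s` copies of `P_1 × Z`, where `Z` is the cycle of girth `g`. -/
abbrev Raw (s l g : ℕ) : Type :=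
  (Fin (l + 1) × ZMod (s * g)) ⊕ (Σ _ : Fin s, Fin 2 × ZMod g)

/-- The disjoint union of `P_l × B` and of `s` copies of `P_1 × Z`. -/
def raw (s l g : ℕ) : ReflGraph (Raw s l g) :=
  ((path l).prod (cycle (s * g))).sum (sigma fun _ : Fin s => (path 1).prod (cycle g))

/-- The identifications that make the sum gadget. -/
inductive Glue (s l g : ℕ) : Raw s l g → Raw s l g → Prop
  /-- In the last slice, `(l, i + j s)` is identified with `(l, i' + j s)`, for `i, i' < s` and
  `j < g`. -/
  | last (i i' : Fin s) (j : Fin g) :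
      Glue s l g (Sum.inl (Fin.last l, ((i.val + j.val * s : ℕ) : ZMod (s * g))))
        (Sum.inl (Fin.last l, ((i'.val + j.val * s : ℕ) : ZMod (s * g))))
  /-- In the first slice, all `(0, i g)` with `i < s` are identified. -/
  | first (i i' : Fin s) :
      Glue s l g (Sum.inl (0, ((i.val * g : ℕ) : ZMod (s * g))))
        (Sum.inl (0, ((i'.val * g : ℕ) : ZMod (s * g))))
  /-- The slice `0 × Z` of the `i`-th copy of `P_1 × Z` is identified with the `i`-th of the copies
  of `Z` that the first slice has become. -/
  | collar (i : Fin s) (j : Fin g) :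
      Glue s l g (Sum.inr ⟨i, (0, ((j.val : ℕ) : ZMod g))⟩)
        (Sum.inl (0, ((i.val * g + j.val : ℕ) : ZMod (s * g))))

/-- The vertices of the sum gadget. -/
abbrev Vertex (s l g : ℕ) : Type := Quot (Glue s l g)

/-- The sum gadget `S_s`, made from a path-of-cycles with `l + 1` slices. -/
def graph (s l g : ℕ) : ReflGraph (Vertex s l g) := (raw s l g).quot (Glue s l g)

variable {s l g : ℕ}

/-- The (image of the) vertex `(k, x)` of `P_l × B`. -/
def body (k : Fin (l + 1)) (x : ZMod (s * g)) : Vertex s l g := Quot.mk _ (Sum.inl (k, x))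

/-- The vertex `j` of `A_i`. -/
def armVertex (i : Fin s) (j : ZMod g) : Vertex s l g := Quot.mk _ (Sum.inr ⟨i, (1, j)⟩)

/-- The vertex `j` of the copy of `Z` in the sum gadget, which is the identified last slice. -/
def endVertex (j : ℕ) : Vertex s l g := body (Fin.last l) ((j * s : ℕ) : ZMod (s * g))

theorem body_adj {k k' : Fin (l + 1)} {x y : ZMod (s * g)} (hk : (path l).Adj k k')
    (hx : (cycle (s * g)).Adj x y) : (graph s l g).Adj (body k x) (body k' y) :=
  ⟨_, _, rfl, rfl, Or.inl ⟨_, _, rfl, rfl, hk, hx⟩⟩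

/-- The slice `k × B` of the path-of-cycles, as a closed walk in the gadget. -/
def slice (k : Fin (l + 1)) : (graph s l g).ClosedWalk where
  len := s * g
  vert i := body k ((i.val : ℕ) : ZMod (s * g))
  adj i := body_adj ((path l).refl k) (Or.inr (Or.inl (by simp)))
  closed := by simp

/-- The cycle `A_i`. -/
def arm (i : Fin s) : (graph s l g).ClosedWalk where
  len := g
  vert j := armVertex i ((j.val : ℕ) : ZMod g)
  adj j := ⟨_, _, rfl, rfl, Or.inr ⟨_, _, rfl, rfl, i, _, _, rfl, rfl, (path 1).refl 1,
    Or.inr (Or.inl (by simp))⟩⟩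
  closed := by simp

theorem endVertex_adj (j : Fin g) :
    (graph s l g).Adj (endVertex j.val) (endVertex (j.val + 1)) := by
  rcases Nat.eq_zero_or_pos s with rfl | hs
  · exact body_adj ((path l).refl _) (Or.inl (by simp))
  · have e : (endVertex j.val : Vertex s l g) =
        body (Fin.last l) (((s - 1) + j.val * s : ℕ) : ZMod (s * g)) := by
      have := Quot.sound (Glue.last (l := l) (⟨0, hs⟩ : Fin s) ⟨s - 1, by omega⟩ j)
      simpa [endVertex, body] using this
    rw [e]
    refine body_adj ((path l).refl _) (Or.inr (Or.inl ?_))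
    have : (j.val + 1) * s = (s - 1) + j.val * s + 1 := by
      rw [Nat.add_mul]
      omega
    rw [this]
    push_cast
    rfl

/-- The copy of `Z` that the last slice has become. -/
def endCycle : (graph s l g).ClosedWalk where
  len := g
  vert j := endVertex j.val
  adj j := endVertex_adj j
  closed := by simp [endVertex, mul_comm g s]

/-- The end gadget-cycles: `Z` and the `A_i`. -/
def IsEndGadgetCycle (c : (graph s l g).ClosedWalk) : Prop :=
  c = endCycle ∨ ∃ i, c = arm i

/-- The gadget-cycles: the cycles that are a slice of the path-of-cycles (in the case of the
last slice, also in the form `Z` without repeated vertices) or an `A_i`. -/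
def IsGadgetCycle (c : (graph s l g).ClosedWalk) : Prop :=
  c.IsCycle ∧ ((∃ k, c = slice k) ∨ IsEndGadgetCycle c)

/-- The vertices of the tree `T(S)`: the `(k, 0)`, and the vertex `0` of each `A_i`. The tree is
the subgraph that they induce. -/
def treeVerts (s l g : ℕ) : Set (Vertex s l g) :=
  {x | (∃ k, x = body k 0) ∨ ∃ i, x = armVertex i 0}

end SumGadget

/-! ## The preliminary construction -/

/-- A choice, for each edge of `G`, of the order in which its two ends are named. -/
structure EdgeOrder {V : Type*} (G : SimpleGraph V) where
  fst : G.edgeSet → V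
  snd : G.edgeSet → V
  mk_eq : ∀ e, s(fst e, snd e) = e.1

namespace Prelim

open ReflGraph

/-- The gadgets used in the construction: `S^v`, `S^v_{i,j}` for `i < j`, and `S_i^{uv}` for each
edge `uv`. -/
inductive Gadget {V : Type*} (G : SimpleGraph V) : Type _
  | atVertex (v : V) : Gadget G
  | atPair (v : V) (i j : Fin 3) (h : i < j) : Gadget G
  | atEdge (e : G.edgeSet) (i : Fin 3) : Gadget G

/-- The gadget is a copy of `S_3` or of `S_2`. -/
def Gadget.size {V : Type*} {G : SimpleGraph V} : Gadget G → ℕ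
  | atVertex _ => 3
  | atPair _ _ _ _ => 2
  | atEdge _ _ => 2

/-- The copies of `S_2` are made with a path of length `l₂`, those of `S_3` with one of
length `l₃`. -/
def Gadget.pathLen {V : Type*} {G : SimpleGraph V} (l₂ l₃ : ℕ) : Gadget G → ℕ
  | atVertex _ => l₃
  | atPair _ _ _ _ => l₂
  | atEdge _ _ => l₂

section

variable {V : Type*} (G : SimpleGraph V) (o : EdgeOrder G) (g l₂ l₃ : ℕ)

/-- The graph of a gadget. -/
abbrev gadgetGraph (γ : Gadget G) :
    ReflGraph (SumGadget.Vertex γ.size (γ.pathLen l₂ l₃) g) :=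
  SumGadget.graph γ.size (γ.pathLen l₂ l₃) g

/-- The vertices of the disjoint union of the cycles `A^v_i`, the cycle `Z^*` and all gadgets. -/
abbrev Raw : Type _ :=
  (Σ _ : V × Fin 3, ZMod g) ⊕
    (ZMod g ⊕ Σ γ : Gadget G, SumGadget.Vertex γ.size (γ.pathLen l₂ l₃) g)

/-- The disjoint union of the cycles `A^v_i`, the cycle `Z^*` and all gadgets. -/
def raw : ReflGraph (Raw G g l₂ l₃) :=
  (sigma fun _ : V × Fin 3 => cycle g).sum
    ((cycle g).sum (sigma fun γ : Gadget G => gadgetGraph G g l₂ l₃ γ))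

variable {G}

/-- The vertex `j` of `A^v_i`. -/
def rawArm {g l₂ l₃ : ℕ} (v : V) (i : Fin 3) (j : ZMod g) : Raw G g l₂ l₃ := Sum.inl ⟨(v, i), j⟩

/-- The vertex `j` of `Z^*`. -/
def rawStar {g l₂ l₃ : ℕ} (j : ZMod g) : Raw G g l₂ l₃ := Sum.inr (Sum.inl j)

/-- The vertex `x` of the gadget `γ`. -/
def rawGadget {g l₂ l₃ : ℕ} (γ : Gadget G) (x : SumGadget.Vertex γ.size (γ.pathLen l₂ l₃) g) :
    Raw G g l₂ l₃ := Sum.inr (Sum.inr ⟨γ, x⟩)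

open SumGadget Gadget in
/-- The identifications of the construction. -/
inductive Glue : Raw G g l₂ l₃ → Raw G g l₂ l₃ → Prop
  /-- The copy of `Z` in `S^v` is identified with `Z^*`. -/
  | center (v : V) (j : ℕ) :
      Glue (rawGadget (atVertex v) (endVertex (s := 3) (l := l₃) (g := g) j)) (rawStar (j : ZMod g))
  /-- The copy of `A_i` in `S^v` is identified with `A^v_i`. -/
  | vertexArm (v : V) (i : Fin 3) (k : ZMod g) :
      Glue (rawGadget (atVertex v) (armVertex (s := 3) (l := l₃) i k)) (rawArm v i k)
  /-- The copy of `A_0` in `S^v_{i,j}` is identified with `A^v_i`. -/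
  | pairFst (v : V) (i j : Fin 3) (h : i < j) (k : ZMod g) :
      Glue (rawGadget (atPair v i j h) (armVertex (s := 2) (l := l₂) 0 k)) (rawArm v i k)
  /-- The copy of `A_1` in `S^v_{i,j}` is identified with `A^v_j` with the opposite orientation. -/
  | pairSnd (v : V) (i j : Fin 3) (h : i < j) (k : ZMod g) :
      Glue (rawGadget (atPair v i j h) (armVertex (s := 2) (l := l₂) 1 k)) (rawArm v j (-k))
  /-- The copy of `A_0` in `S_i^{uv}` is identified with `A^u_i`. -/
  | edgeFst (e : G.edgeSet) (i : Fin 3) (k : ZMod g) :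
      Glue (rawGadget (atEdge e i) (armVertex (s := 2) (l := l₂) 0 k)) (rawArm (o.fst e) i k)
  /-- The copy of `A_1` in `S_i^{uv}` is identified with `A^v_i`. -/
  | edgeSnd (e : G.edgeSet) (i : Fin 3) (k : ZMod g) :
      Glue (rawGadget (atEdge e i) (armVertex (s := 2) (l := l₂) 1 k)) (rawArm (o.snd e) i k)

/-- The vertices of the first-stage graph. -/
abbrev Vertex : Type _ := Quot (Glue o g l₂ l₃)

/-- The first-stage graph constructed from `G`. -/
def graph : ReflGraph (Vertex o g l₂ l₃) := (raw G g l₂ l₃).quot (Glue o g l₂ l₃)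

/-- The map of a gadget into the first-stage graph. -/
def incl (γ : Gadget G) : (gadgetGraph G g l₂ l₃ γ).Hom (graph o g l₂ l₃) where
  toFun x := Quot.mk _ (rawGadget γ x)
  map_adj h := ⟨_, _, rfl, rfl, Or.inr ⟨_, _, rfl, rfl, Or.inr ⟨_, _, rfl, rfl, γ, _, _, rfl, rfl, h⟩⟩⟩

/-- The gadget-cycles of the first-stage graph are those of the gadgets. -/
def gadgetCycles : Set (graph o g l₂ l₃).ClosedWalk :=
  {c | ∃ (γ : Gadget G) (d : (gadgetGraph G g l₂ l₃ γ).ClosedWalk),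
    SumGadget.IsGadgetCycle d ∧ c = d.map (incl o g l₂ l₃ γ)}

/-- The end gadget-cycles of the first-stage graph are those of the gadgets. -/
def endGadgetCycles : Set (graph o g l₂ l₃).ClosedWalk :=
  {c | ∃ (γ : Gadget G) (d : (gadgetGraph G g l₂ l₃ γ).ClosedWalk),
    SumGadget.IsEndGadgetCycle d ∧ c = d.map (incl o g l₂ l₃ γ)}

/-- The vertices of `T^*`. -/
def treeVerts : Set (Vertex o g l₂ l₃) :=
  {x | ∃ γ : Gadget G, ∃ a ∈ SumGadget.treeVerts γ.size (γ.pathLen l₂ l₃) g,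
    (incl o g l₂ l₃ γ).toFun a = x}

/-- The subgraph `T^*`, the union of the trees `T(S)` of all gadgets `S`. -/
def treeUnion : ReflGraph (treeVerts o g l₂ l₃) where
  Adj x y := ∃ γ : Gadget G, ∃ a ∈ SumGadget.treeVerts γ.size (γ.pathLen l₂ l₃) g,
    ∃ b ∈ SumGadget.treeVerts γ.size (γ.pathLen l₂ l₃) g,
      (incl o g l₂ l₃ γ).toFun a = x.1 ∧ (incl o g l₂ l₃ γ).toFun b = y.1 ∧
        (gadgetGraph G g l₂ l₃ γ).Adj a b
  symm := by
    rintro x y ⟨γ, a, ha, b, hb, hx, hy, h⟩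
    exact ⟨γ, b, hb, a, ha, hy, hx, (gadgetGraph G g l₂ l₃ γ).symm h⟩
  refl := by
    rintro ⟨x, γ, a, ha, hx⟩
    exact ⟨γ, a, ha, a, ha, hx, hx, (gadgetGraph G g l₂ l₃ γ).refl a⟩

/-- The inclusion of `T^*` into the first-stage graph. -/
def treeIncl : (treeUnion o g l₂ l₃).Hom (graph o g l₂ l₃) where
  toFun := Subtype.val
  map_adj := by
    rintro x y ⟨γ, a, _, b, _, hx, hy, h⟩
    rw [← hx, ← hy]
    exact (incl o g l₂ l₃ γ).map_adj h

/-- Cycles of `T^*`, as cycles of the first-stage graph. -/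
def treeCycles (BT : Set (treeUnion o g l₂ l₃).ClosedWalk) : Set (graph o g l₂ l₃).ClosedWalk :=
  ReflGraph.ClosedWalk.map (treeIncl o g l₂ l₃) '' BT

end

end Prelim

/-! Homology is handled through cocycles. A family of closed walks spans $H_1$ as soon as every
cocycle, with values in any abelian group, that vanishes on the family is a coboundary
(`span_cls_eq_top`, by means of a universal cocycle). It is independent as soon as integer cocycles
separate its members (`linearIndependent_cls`).

The set $\mathcal A$ consists of $Z^*$ and of $A^v_0, A^v_1$ for all $v$; the same cycles serve for
both conclusions. In a sum gadget $[Z]=\sum_i[A_i]$ (`endCycle_sum_eq`), and a cocycle vanishing on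
all the $A_i$ is a coboundary (`SumGadget.exists_potential`). Spanning follows: a cocycle vanishing
on $\mathcal A$ vanishes on every $A^v_2$ by the relation in $S^v$, hence on the arms of every
gadget, so it has a potential on each gadget. The free constants of these potentials are fixed by a
potential on $T^*$. The potentials then agree at the vertex $0$ of every glued cycle, hence on the
whole cycle, and they glue (`exists_potential_graph`). The potential on $T^*$ comes from $\mathcal
B_T$ (`exists_potential_of_span`). After plugging, it exists because every cocycle of $G^*$ vanishes
on the plugged cycles (`IsCocycle.sum_plug`).

The copies of $S_2$ give no relation among the $A^v_i$, as their own $Z$ is free. The only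
constraint on values at the $A^v_i$ is that the sum over $i$ is the same for all $v$, and all
integer values subject to it are realised, up to the factor $g$, by cocycles vanishing on $T^*$
(`exists_cocycle`). Such a cocycle is built from maps of the gadgets to $C_g$: near the arms, one
map per arm, wrapping one arc of length $g$; near $Z$, the map $x\mapsto\lfloor x/s\rfloor$. The two
descriptions differ by an explicit coboundary on the middle slices (`cycStep_arcMap`). Cocycles
vanishing on $T^*$ extend by zero to the plugged graph. In $\Gamma$ itself, $\mathcal A$ is
separated from $\mathcal B_T$ by the retraction onto $T^*$ collapsing all slices
(`exists_retraction`).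

Finally, $T^*$ is connected and triangle-free, so the fundamental cycles of a spanning tree form an
NT-basis (`exists_ntBasis_isCycle`). -/

namespace ReflGraph

universe u

/-! ## Cocycles and the first homology group -/

section Cocycle

variable {V W : Type*} {K : ReflGraph V} {L : ReflGraph W} {Q : Type*} [AddCommGroup Q]

/-- A `Q`-valued `1`-cocycle, as a function of pairs of vertices. -/
def IsCocycle (K : ReflGraph V) (f : V → V → Q) : Prop :=
  ∀ ⦃x y z⦄, K.Adj x y → K.Adj y z → K.Adj x z → f x y + f y z = f x z

theorem IsCocycle.self {f : V → V → Q} (hf : K.IsCocycle f) (x : V) : f x x = 0 := by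
  have := hf (K.refl x) (K.refl x) (K.refl x)
  simpa using this

theorem IsCocycle.neg_symm {f : V → V → Q} (hf : K.IsCocycle f) {x y : V} (h : K.Adj x y) :
    f y x = -f x y := by
  have := hf h (K.symm h) (K.refl x)
  rw [hf.self] at this
  exact (neg_eq_of_add_eq_zero_right this).symm

theorem IsCocycle.comp {f : W → W → Q} (hf : L.IsCocycle f) (φ : K.Hom L) :
    K.IsCocycle fun x y => f (φ.toFun x) (φ.toFun y) :=
  fun _ _ _ h h' h'' => hf (φ.map_adj h) (φ.map_adj h') (φ.map_adj h'')

/-- A function on pairs of vertices, extended linearly to `1`-chains. -/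
noncomputable def cochainMap (K : ReflGraph V) (f : V → V → Q) : K.Chain 1 →ₗ[ℤ] Q :=
  Finsupp.linearCombination ℤ fun σ : K.Simplex 1 => f (σ.1 0) (σ.1 1)

theorem cochainMap_single (f : V → V → Q) (σ : K.Simplex 1) :
    K.cochainMap f (Finsupp.single σ 1) = f (σ.1 0) (σ.1 1) := by
  rw [cochainMap, Finsupp.linearCombination_single, one_smul]

@[simp]
theorem cochainMap_edge (f : V → V → Q) {x y : V} (h : K.Adj x y) :
    K.cochainMap f (Finsupp.single (K.edge h) 1) = f x y :=
  cochainMap_single f _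

theorem cochainMap_boundary {f : V → V → Q} (hf : K.IsCocycle f) (τ : K.Chain 2) :
    K.cochainMap f (K.boundary 1 τ) = 0 := by
  suffices h : K.cochainMap f ∘ₗ K.boundary 1 = 0 from LinearMap.congr_fun h τ
  refine Finsupp.lhom_ext' fun σ => LinearMap.ext_ring ?_
  have h := hf (σ.2 0 1) (σ.2 1 2) (σ.2 0 2)
  have h0 : K.cochainMap f (Finsupp.single (σ.face 0) 1) = f (σ.1 1) (σ.1 2) :=
    cochainMap_single f _
  have h1 : K.cochainMap f (Finsupp.single (σ.face 1) 1) = f (σ.1 0) (σ.1 2) :=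
    cochainMap_single f _
  have h2 : K.cochainMap f (Finsupp.single (σ.face 2) 1) = f (σ.1 0) (σ.1 1) :=
    cochainMap_single f _
  have e : K.boundary 1 (Finsupp.single σ 1) = Finsupp.single (σ.face 0) 1 -
      Finsupp.single (σ.face 1) 1 + Finsupp.single (σ.face 2) 1 := by
    rw [boundary, Finsupp.linearCombination_single, one_smul, Fin.sum_univ_three]
    simp [sub_eq_add_neg]
  simp only [LinearMap.comp_apply, Finsupp.lsingle_apply, e, map_add, map_sub, h0, h1, h2, ← h,
    LinearMap.zero_apply]
  abel

/-- The homomorphism on the first homology group given by a cocycle. -/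
noncomputable def IsCocycle.eval {f : V → V → Q} (hf : K.IsCocycle f) : K.H1 →ₗ[ℤ] Q :=
  Submodule.liftQ _ (K.cochainMap f ∘ₗ K.Z1.subtype) <| by
    rintro ⟨z, hz⟩ ⟨τ, hτ⟩
    simp only [Submodule.subtype_apply] at hτ
    simp [← hτ, cochainMap_boundary hf]

/-- The sum of the values of a function along a closed walk. -/
def ClosedWalk.sum (c : K.ClosedWalk) (f : V → V → Q) : Q :=
  ∑ i : Fin c.len, f (c.vert i.castSucc) (c.vert i.succ)

theorem ClosedWalk.sum_map (c : K.ClosedWalk) (φ : K.Hom L) (f : W → W → Q) :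
    (c.map φ).sum f = c.sum fun x y => f (φ.toFun x) (φ.toFun y) := rfl

theorem cochainMap_chain (f : V → V → Q) (c : K.ClosedWalk) :
    K.cochainMap f c.chain = c.sum f := by
  simp [ClosedWalk.chain, ClosedWalk.sum]

@[simp]
theorem IsCocycle.eval_cls {f : V → V → Q} (hf : K.IsCocycle f) (c : K.ClosedWalk) :
    hf.eval c.cls = c.sum f := by
  rw [← cochainMap_chain]
  rfl

theorem ClosedWalk.sum_coboundary (c : K.ClosedWalk) (h : V → Q) :
    (c.sum fun x y => h y - h x) = 0 := by
  have e1 := Fin.sum_univ_succ fun i : Fin (c.len + 1) => h (c.vert i)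
  have e2 := Fin.sum_univ_castSucc fun i : Fin (c.len + 1) => h (c.vert i)
  rw [e1, c.closed, add_comm] at e2
  rw [ClosedWalk.sum, Finset.sum_sub_distrib, add_right_cancel e2, sub_self]

theorem ClosedWalk.sum_congr (c : K.ClosedWalk) {f f' : V → V → Q}
    (h : ∀ x y, K.Adj x y → f x y = f' x y) : c.sum f = c.sum f' :=
  Finset.sum_congr rfl fun i _ => h _ _ (c.adj i)

/-- `1`-chains modulo boundaries. -/
abbrev ChainClass (K : ReflGraph V) : Type _ := K.Chain 1 ⧸ LinearMap.range (K.boundary 1)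

open Classical in
/-- The universal cocycle. -/
noncomputable def univCocycle (K : ReflGraph V) (x y : V) : K.ChainClass :=
  if h : K.Adj x y then Submodule.Quotient.mk (Finsupp.single (K.edge h) 1) else 0

theorem cochainMap_univCocycle (z : K.Chain 1) :
    K.cochainMap K.univCocycle z = Submodule.Quotient.mk z := by
  suffices h : K.cochainMap K.univCocycle = Submodule.mkQ _ from LinearMap.congr_fun h z
  refine Finsupp.lhom_ext' fun σ => LinearMap.ext_ring ?_
  have e : K.edge (σ.2 0 1) = σ := by
    apply Subtype.ext
    funext i
    fin_cases i <;> rfl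
  simp [cochainMap, univCocycle, σ.2 0 1, e]

theorem isCocycle_univCocycle (K : ReflGraph V) : K.IsCocycle K.univCocycle := by
  intro x y z hxy hyz hxz
  rw [← sub_eq_zero]
  simp only [univCocycle, hxy, hyz, hxz, dite_true]
  rw [← Submodule.Quotient.mk_add, ← Submodule.Quotient.mk_sub, Submodule.Quotient.mk_eq_zero]
  have hs : ∀ i j : Fin 3, K.Adj (![x, y, z] i) (![x, y, z] j) := by
    intro i j
    fin_cases i <;> fin_cases j
    exacts [K.refl x, hxy, hxz, K.symm hxy, K.refl y, hyz, K.symm hxz, K.symm hyz, K.refl z]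
  let σ : K.Simplex 2 := ⟨![x, y, z], hs⟩
  refine ⟨Finsupp.single σ 1, ?_⟩
  have h0 : σ.face 0 = K.edge hyz := by
    apply Subtype.ext
    funext i
    fin_cases i <;> rfl
  have h1 : σ.face 1 = K.edge hxz := by
    apply Subtype.ext
    funext i
    fin_cases i <;> rfl
  have h2 : σ.face 2 = K.edge hxy := by
    apply Subtype.ext
    funext i
    fin_cases i <;> rfl
  simp [boundary, Fin.sum_univ_three, h0, h1, h2]
  abel

/-- A $1$-cycle has class zero exactly when it is a boundary as a chain, so $H_1$ embeds in chains
modulo boundaries. This makes one cocycle enough to detect the whole of $H_1$, both for spanning and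
for transporting independence. -/
theorem eval_univCocycle_injective (K : ReflGraph V) :
    Function.Injective K.isCocycle_univCocycle.eval := by
  rw [injective_iff_map_eq_zero]
  intro a
  induction a using Submodule.Quotient.induction_on with
  | H z =>
    intro h
    have h' : K.cochainMap K.univCocycle z.1 = 0 := h
    rw [cochainMap_univCocycle, Submodule.Quotient.mk_eq_zero] at h'
    rw [Submodule.Quotient.mk_eq_zero]
    exact h'

/-- On a cycle, a coboundary evaluates to zero. -/
theorem cochainMap_coboundary (h : V → Q) {z : K.Chain 1} (hz : z ∈ K.Z1) :
    K.cochainMap (fun x y => h y - h x) z = 0 := by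
  have e : K.cochainMap (fun x y => h y - h x) =
      (Finsupp.linearCombination ℤ fun σ : K.Simplex 0 => h (σ.1 0)) ∘ₗ K.boundary 0 := by
    refine Finsupp.lhom_ext' fun σ => LinearMap.ext_ring ?_
    have e : K.boundary 0 (Finsupp.single σ 1) =
        Finsupp.single (σ.face 0) 1 - Finsupp.single (σ.face 1) 1 := by
      rw [boundary, Finsupp.linearCombination_single, one_smul, Fin.sum_univ_two]
      simp [sub_eq_add_neg]
    simp only [LinearMap.comp_apply, Finsupp.lsingle_apply, e, map_sub, cochainMap_single]
    rw [Finsupp.linearCombination_single, Finsupp.linearCombination_single, one_smul, one_smul]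
    rfl
  rw [e, LinearMap.comp_apply, LinearMap.mem_ker.1 hz, map_zero]

theorem cochainMap_congr {f f' : V → V → Q} (h : ∀ x y, K.Adj x y → f x y = f' x y) :
    K.cochainMap f = K.cochainMap f' := by
  refine Finsupp.lhom_ext' fun σ => LinearMap.ext_ring ?_
  simp [cochainMap, h _ _ (σ.2 0 1)]

end Cocycle

/-- Closed walks span the homology if each cocycle that vanishes on them is a coboundary. -/
theorem span_cls_eq_top {V : Type u} {K : ReflGraph V} {B : Set K.ClosedWalk}
    (H : ∀ (Q : Type u) [AddCommGroup Q] (f : V → V → Q), K.IsCocycle f →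
      (∀ c ∈ B, c.sum f = 0) → ∃ h : V → Q, ∀ x y, K.Adj x y → f x y = h y - h x) :
    Submodule.span ℤ (ClosedWalk.cls '' B) = ⊤ := by
  -- The test group is chains modulo boundaries, further divided by the image `N` of the span. The
  -- universal cocycle mod `N` vanishes on `B`; once it is a coboundary, every class maps into `N`,
  -- and injectivity of `E` puts the class in the span.
  let S := Submodule.span ℤ (ClosedWalk.cls '' B)
  let E := K.isCocycle_univCocycle.eval
  let N : Submodule ℤ K.ChainClass := S.map E
  have hf : K.IsCocycle fun x y => N.mkQ (K.univCocycle x y) := fun x y z h h' h'' => by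
    rw [← map_add, K.isCocycle_univCocycle h h' h'']
  have hE : ∀ z : K.Z1, K.cochainMap (fun x y => N.mkQ (K.univCocycle x y)) z.1 =
      N.mkQ (E (Submodule.Quotient.mk z)) := by
    intro z
    have : K.cochainMap (fun x y => N.mkQ (K.univCocycle x y)) =
        N.mkQ ∘ₗ K.cochainMap K.univCocycle := by
      refine Finsupp.lhom_ext' fun σ => LinearMap.ext_ring ?_
      simp [cochainMap]
    rw [this]
    rfl
  obtain ⟨h, hh⟩ := H (K.ChainClass ⧸ N) (fun x y => N.mkQ (K.univCocycle x y)) hf fun c hc => by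
    rw [← cochainMap_chain, hE ⟨c.chain, c.chain_mem⟩, Submodule.mkQ_apply,
      Submodule.Quotient.mk_eq_zero]
    exact ⟨c.cls, Submodule.subset_span ⟨c, hc, rfl⟩, rfl⟩
  rw [eq_top_iff]
  rintro a -
  induction a using Submodule.Quotient.induction_on with
  | H z =>
    have h1 := hE z
    rw [cochainMap_congr hh, cochainMap_coboundary h z.2, eq_comm, Submodule.mkQ_apply,
      Submodule.Quotient.mk_eq_zero] at h1
    obtain ⟨w, hw, e⟩ := h1
    rw [← K.eval_univCocycle_injective e]
    exact hw

/-! ### Potentials of cocycles on a connected graph -/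

section Potential

variable {V : Type*} {K : ReflGraph V} {Q : Type*} [AddCommGroup Q]

/-- If closed walks span the homology of a connected graph, then each cocycle that vanishes on them
is a coboundary. -/
theorem exists_potential_of_span {B : Set K.ClosedWalk}
    (hB : Submodule.span ℤ (ClosedWalk.cls '' B) = ⊤) {x₀ : V}
    (hK : ∀ x, Relation.ReflTransGen K.Adj x₀ x) {f : V → V → Q} (hf : K.IsCocycle f)
    (hfB : ∀ c ∈ B, c.sum f = 0) : ∃ h : V → Q, ∀ x y, K.Adj x y → f x y = h y - h x := by
  have hE : hf.eval = 0 := by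
    have : Set.EqOn hf.eval (0 : K.H1 →ₗ[ℤ] Q) (ClosedWalk.cls '' B) := by
      rintro _ ⟨c, hc, rfl⟩
      simpa using hfB c hc
    exact LinearMap.ext_on hB this
  have hz : ∀ z ∈ K.Z1, K.cochainMap f z = 0 := fun z hz =>
    LinearMap.congr_fun hE (Submodule.Quotient.mk ⟨z, hz⟩)
  let pt : V → K.Chain 0 := fun x => Finsupp.single ⟨fun _ => x, fun _ _ => K.refl x⟩ 1
  have hedge : ∀ {x y : V} (h : K.Adj x y),
      K.boundary 0 (Finsupp.single (K.edge h) (1 : ℤ)) = pt y - pt x := by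
    intro x y h
    have h0 : (K.edge h).face 0 = ⟨fun _ => y, fun _ _ => K.refl y⟩ := by
      apply Subtype.ext
      funext j
      fin_cases j
      rfl
    have h1 : (K.edge h).face 1 = ⟨fun _ => x, fun _ _ => K.refl x⟩ := by
      apply Subtype.ext
      funext j
      fin_cases j
      rfl
    rw [boundary, Finsupp.linearCombination_single, Fin.sum_univ_two, h0, h1]
    simp [pt, sub_eq_add_neg]
  -- Connectedness gives a chain from `x₀` to each `x`. The potential at `x` is the value of `f` on
  -- it, and the choice does not matter because `f` kills all $1$-cycles.
  have hc : ∀ x, ∃ c : K.Chain 1, K.boundary 0 c = pt x - pt x₀ := by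
    intro x
    induction hK x with
    | refl => exact ⟨0, by simp⟩
    | @tail y z _ h ih =>
      obtain ⟨c, hc⟩ := ih
      exact ⟨c + Finsupp.single (K.edge h) 1, by rw [map_add, hc, hedge]; abel⟩
  choose c hc using hc
  refine ⟨fun x => K.cochainMap f (c x), fun x y h => ?_⟩
  have := hz (c x + Finsupp.single (K.edge h) 1 - c y) (by
    rw [LinearMap.mem_ker, map_sub, map_add, hc, hc, hedge]
    abel)
  rw [map_sub, map_add, cochainMap_edge] at this
  rw [← sub_eq_zero, ← this]
  abel

end Potential

/-! ## Plugging -/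

section Plug

variable {V : Type*} {K : ReflGraph V} {B : Set K.ClosedWalk} {Q : Type*} [AddCommGroup Q]

/-- A cocycle of the plugged graph vanishes on the plugged closed walks. -/
theorem IsCocycle.sum_plug {f : V ⊕ B → V ⊕ B → Q} (hf : (K.plug B).IsCocycle f) (c : B) :
    (c.1.sum fun x y => f (Sum.inl x) (Sum.inl y)) = 0 := by
  -- The new vertex is the apex of a cone over the walk: the triangle on an edge and the apex writes
  -- `f` on that edge as a difference of values on spokes.
  rw [← c.1.sum_coboundary fun x => -f (Sum.inl x) (Sum.inr c)]
  refine Finset.sum_congr rfl fun i _ => ?_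
  have h := hf (x := Sum.inl (c.1.vert i.castSucc)) (y := Sum.inl (c.1.vert i.succ))
    (z := Sum.inr c) (c.1.adj i) ⟨_, rfl⟩ ⟨_, rfl⟩
  change f _ _ = -f _ _ - -f _ _
  rw [← h]
  abel

/-- A potential on a graph extends to the graph with some closed walks plugged. -/
theorem exists_potential_plug {f : V ⊕ B → V ⊕ B → Q} (hf : (K.plug B).IsCocycle f)
    (H : ∃ h : V → Q, ∀ x y, K.Adj x y → f (Sum.inl x) (Sum.inl y) = h y - h x) :
    ∃ h : V ⊕ B → Q, ∀ x y, (K.plug B).Adj x y → f x y = h y - h x := by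
  obtain ⟨h, hh⟩ := H
  -- The potential at the apex is forced to be $h(x)+f(x,v_c)$; the cone triangles show that this
  -- does not depend on the vertex $x$ of the walk.
  have key : ∀ (c : B) (i : Fin (c.1.len + 1)),
      h (c.1.vert i) + f (Sum.inl (c.1.vert i)) (Sum.inr c) =
        h (c.1.vert 0) + f (Sum.inl (c.1.vert 0)) (Sum.inr c) := by
    intro c i
    induction i using Fin.induction with
    | zero => rfl
    | succ i ih =>
      rw [← ih]
      have h1 := hf (x := Sum.inl (c.1.vert i.castSucc)) (y := Sum.inl (c.1.vert i.succ))
        (z := Sum.inr c) (c.1.adj i) ⟨_, rfl⟩ ⟨_, rfl⟩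
      rw [hh _ _ (c.1.adj i)] at h1
      rw [← h1]
      abel
  have key' : ∀ (c : B) (x : V), x ∈ c.1.support →
      f (Sum.inl x) (Sum.inr c) =
        h (c.1.vert 0) + f (Sum.inl (c.1.vert 0)) (Sum.inr c) - h x := by
    rintro c _ ⟨i, rfl⟩
    rw [← key c i]
    abel
  refine ⟨Sum.elim h fun c => h (c.1.vert 0) + f (Sum.inl (c.1.vert 0)) (Sum.inr c), ?_⟩
  rintro (x | c) (y | d) hxy
  · exact hh x y hxy
  · exact key' d x hxy
  · rw [hf.neg_symm ((K.plug B).symm hxy), key' c y hxy]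
    simp
  · obtain rfl : c = d := hxy
    rw [hf.self, sub_self]

/-- A cocycle that vanishes on the edges between vertices of the plugged walks extends by zero. -/
theorem IsCocycle.extend_plug {f : V → V → Q} (hf : K.IsCocycle f)
    (h0 : ∀ c ∈ B, ∀ x ∈ c.support, ∀ y ∈ c.support, f x y = 0) :
    (K.plug B).IsCocycle fun x y : V ⊕ B => match x, y with
      | Sum.inl x, Sum.inl y => f x y
      | _, _ => 0 := by
  rintro (x | c) (y | d) (z | e) h h' h''
  · exact hf h h' h''
  · simpa using h0 _ e.2 _ h'' _ h'
  · simp only [add_zero]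
    exact (h0 _ d.2 _ h _ h').symm
  · simp
  · simpa using h0 _ c.2 _ h _ h''
  · simp
  · simp
  · simp

end Plug

/-! ## Linear independence -/

/-- Classes of closed walks are linearly independent if cocycles separate them. -/
theorem linearIndependent_cls {V ι : Type*} {K : ReflGraph V} (c : ι → K.ClosedWalk)
    (H : ∀ i, ∃ f : V → V → ℤ, K.IsCocycle f ∧ (c i).sum f ≠ 0 ∧ ∀ j, j ≠ i → (c j).sum f = 0) :
    LinearIndependent ℤ fun i => (c i).cls := by
  rw [linearIndependent_iff']
  intro s a ha i hi
  obtain ⟨f, hf, h1, h0⟩ := H i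
  have := congrArg hf.eval ha
  simp only [map_sum, map_smul, IsCocycle.eval_cls, map_zero, smul_eq_mul] at this
  rw [Finset.sum_eq_single i (fun j _ hj => by rw [h0 j hj, mul_zero])
    (fun h => (h hi).elim)] at this
  exact (mul_eq_zero.1 this).resolve_right h1

/-- Passes from an indexed family to the set-indexed form used in `IsNTBasis`, by choosing one index
for each member of the range. -/
theorem linearIndepOn_range_cls {V ι : Type*} {K : ReflGraph V} {c : ι → K.ClosedWalk}
    (h : LinearIndependent ℤ fun i => (c i).cls) :
    LinearIndependent ℤ fun d : Set.range c => d.1.cls := by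
  have e : (fun d : Set.range c => d.1.cls) =
      (fun i => (c i).cls) ∘ Set.rangeSplitting c := by
    funext d
    simp [Set.apply_rangeSplitting]
  rw [e]
  exact h.comp _ (Set.rangeSplitting_injective c)

end ReflGraph

namespace ReflGraph

universe u

/-! ## Triangle-free graphs -/

section Tree

variable {V : Type*} {Q : Type*} [AddCommGroup Q]

/-- On a tree, each antisymmetric function is a coboundary. -/
theorem exists_potential_of_isTree {T : SimpleGraph V} (hT : T.IsTree) {f : V → V → Q}
    (hf : ∀ x y, T.Adj x y → f y x = -f x y) :
    ∃ h : V → Q, ∀ x y, T.Adj x y → f x y = h y - h x := by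
  obtain ⟨r⟩ := hT.connected.nonempty
  choose p hp _ using fun x => hT.existsUnique_path r x
  simp only at hp
  let h : V → Q := fun x => ((p x).darts.map fun d => f d.fst d.snd).sum
  have key : ∀ x y (hxy : T.Adj x y), x ∈ (p y).support → f x y = h y - h x := by
    intro x y hxy hx
    have e := hT.isAcyclic.path_concat (hp x) (hp y) hxy hx
    simp [h, e, SimpleGraph.Walk.darts_concat, List.concat_eq_append]
  refine ⟨h, fun x y hxy => ?_⟩
  -- Of two adjacent vertices of a tree, one lies on the path from the root to the other, and that
  -- path ends with the edge between them.
  by_cases hx : x ∈ (p y).support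
  · exact key x y hxy hx
  · have hy := hT.isAcyclic.mem_support_of_ne_mem_support_of_adj_of_isPath (hp x) (hp y) hxy hx
    rw [hf y x hxy.symm, key y x hxy.symm hy, neg_sub]

variable {K : ReflGraph V} {T : SimpleGraph V}

/-- A walk from `y` to `x`, closed by the edge from `x` to `y`. -/
def closeWalk (hTK : ∀ x y, T.Adj x y → K.Adj x y) {x y : V} (p : T.Walk y x) (h : K.Adj x y) :
    K.ClosedWalk where
  len := p.length + 1
  -- The default is reached only at the final index `p.length + 1`, where the walk returns to its
  -- start.
  vert i := if i.val ≤ p.length then p.getVert i.val else y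
  adj i := by
    obtain ⟨i, hi⟩ := i
    rcases Nat.lt_succ_iff_lt_or_eq.1 hi with hi | rfl
    · have h1 : i ≤ p.length := hi.le
      have h2 : i + 1 ≤ p.length := hi
      simpa [h1, h2] using hTK _ _ (p.adj_getVert_succ hi)
    · simpa using h
  closed := by simp

theorem closeWalk_sum (hTK : ∀ x y, T.Adj x y → K.Adj x y) {x y : V} (p : T.Walk y x)
    (h : K.Adj x y) (f : V → V → Q) : (closeWalk hTK p h).sum f =
      (∑ i : Fin p.length, f (p.getVert i.val) (p.getVert (i.val + 1))) + f x y := by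
  change (∑ i : Fin (p.length + 1), f (if i.val ≤ p.length then p.getVert i.val else y)
    (if i.val + 1 ≤ p.length then p.getVert (i.val + 1) else y)) = _
  rw [Fin.sum_univ_castSucc]
  congr 1
  · refine Finset.sum_congr rfl fun i _ => ?_
    have h1 : i.val ≤ p.length := i.2.le
    have h2 : i.val + 1 ≤ p.length := i.2
    simp [h1, h2]
  · simp

theorem closeWalk_isCycle (hTK : ∀ x y, T.Adj x y → K.Adj x y) {x y : V} {p : T.Walk y x}
    (hp : p.IsPath) (h : K.Adj x y) (hne : x ≠ y) (hT : ¬ T.Adj x y) :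
    (closeWalk hTK p h).IsCycle := by
  constructor
  · change 3 ≤ p.length + 1
    by_contra! hlt
    have : p.length = 0 ∨ p.length = 1 := by omega
    rcases this with h0 | h1
    · exact hne (SimpleGraph.Walk.eq_of_length_eq_zero h0).symm
    · exact hT (SimpleGraph.Walk.adj_of_length_eq_one h1).symm
  · change Function.Injective fun i : Fin (p.length + 1) =>
      if i.val ≤ p.length then p.getVert i.val else y
    intro i j hij
    have h1 : i.val ≤ p.length := Nat.lt_succ_iff.1 i.2
    have h2 : j.val ≤ p.length := Nat.lt_succ_iff.1 j.2
    simp only [h1, h2, if_true] at hij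
    exact Fin.ext (hp.getVert_injOn h1 h2 hij)

open Classical in
/-- The function that counts how often a given directed edge is used. -/
noncomputable def edgeCount (a b : V) (x y : V) : ℤ :=
  (if x = a ∧ y = b then 1 else 0) - (if x = b ∧ y = a then 1 else 0)

/-- Without proper triangles the cocycle identity is only tested on triples with a repetition, where
it amounts to antisymmetry and vanishing on loops. -/
theorem isCocycle_edgeCount (htri : ∀ x y z, K.Adj x y → K.Adj y z → K.Adj x z →
    x = y ∨ y = z ∨ x = z) (a b : V) (hab : a ≠ b) : K.IsCocycle (edgeCount a b) := by
  have h0 : ∀ x, edgeCount a b x x = 0 := by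
    intro x
    have h1 : ¬ (x = a ∧ x = b) := fun h => hab (h.1.symm.trans h.2)
    have h2 : ¬ (x = b ∧ x = a) := fun h => hab (h.2.symm.trans h.1)
    simp [edgeCount, h1, h2]
  intro x y z hxy hyz hxz
  rcases htri x y z hxy hyz hxz with rfl | rfl | rfl
  · rw [h0, zero_add]
  · rw [h0, add_zero]
  · rw [h0]
    grind [edgeCount]

theorem edgeCount_eq_zero {a b x y : V} (h : s(x, y) ≠ s(a, b)) : edgeCount a b x y = 0 := by
  have h1 : ¬ (x = a ∧ y = b) := fun h' => h (by rw [h'.1, h'.2])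
  have h2 : ¬ (x = b ∧ y = a) := fun h' => h (by rw [h'.1, h'.2, Sym2.eq_swap])
  simp [edgeCount, h1, h2]

theorem edgeCount_self {a b : V} (hab : a ≠ b) : edgeCount a b a b = 1 := by
  simp [edgeCount, hab]

end Tree

/-- A connected graph without triangles has an NT-basis consisting of cycles, the fundamental cycles
of a spanning tree. -/
theorem exists_ntBasis_isCycle {V : Type u} [Nonempty V] {K : ReflGraph V}
    (hK : ∀ x y, Relation.ReflTransGen K.Adj x y)
    (htri : ∀ x y z, K.Adj x y → K.Adj y z → K.Adj x z → x = y ∨ y = z ∨ x = z) :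
    ∃ B : Set K.ClosedWalk, IsNTBasis B ∧ ∀ c ∈ B, c.IsCycle := by
  let S : SimpleGraph V :=
    { Adj := fun x y => x ≠ y ∧ K.Adj x y
      symm := ⟨fun x y h => ⟨h.1.symm, K.symm h.2⟩⟩
      loopless := ⟨fun x h => h.1 rfl⟩ }
  have hS : S.Connected := by
    refine ⟨fun x y => ?_⟩
    induction hK x y with
    | refl => exact SimpleGraph.Reachable.refl x
    | @tail y z _ h ih =>
      by_cases e : y = z
      · exact e ▸ ih
      · exact ih.trans (SimpleGraph.Adj.reachable (G := S) ⟨e, h⟩)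
  obtain ⟨T, hTS, hT⟩ := hS.exists_isTree_le
  have hTK : ∀ x y, T.Adj x y → K.Adj x y := fun x y h => (hTS h).2
  -- `Quot.out` selects one of the two orientations of each edge outside the spanning tree, so that
  -- each such edge gives exactly one fundamental cycle.
  let E := {e : V × V // S.Adj e.1 e.2 ∧ ¬ T.Adj e.1 e.2 ∧ (Quot.out s(e.1, e.2)) = e}
  choose p hp _ using fun e : E => hT.existsUnique_path e.1.2 e.1.1
  simp only at hp
  let c : E → K.ClosedWalk := fun e => closeWalk hTK (p e) e.2.1.2
  refine ⟨Set.range c, ⟨linearIndepOn_range_cls (linearIndependent_cls c fun e => ?_), ?_⟩, ?_⟩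
  -- Apart from its closing edge, a fundamental cycle uses only tree edges, so counting a non-tree
  -- edge sees the closing edge alone.
  · have hsum : ∀ e', (c e').sum (edgeCount e.1.1 e.1.2) =
        edgeCount e.1.1 e.1.2 e'.1.1 e'.1.2 := by
      intro e'
      rw [closeWalk_sum, Finset.sum_eq_zero, zero_add]
      intro i _
      refine edgeCount_eq_zero fun h => e.2.2.1 ?_
      rw [← SimpleGraph.mem_edgeSet, ← h, SimpleGraph.mem_edgeSet]
      exact (p e').adj_getVert_succ i.2
    refine ⟨_, isCocycle_edgeCount htri e.1.1 e.1.2 e.2.1.1, ?_, fun e' he => ?_⟩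
    · rw [hsum, edgeCount_self e.2.1.1]
      exact one_ne_zero
    · rw [hsum]
      refine edgeCount_eq_zero fun h => he (Subtype.ext ?_)
      rw [← e.2.2.2, ← e'.2.2.2, h]
  · refine span_cls_eq_top fun Q _ f hf h0 => ?_
    obtain ⟨h, hh⟩ := exists_potential_of_isTree hT fun x y hxy => hf.neg_symm (hTK x y hxy)
    -- Both `f` and the coboundary of `h` sum to zero around the fundamental cycle and agree on its
    -- tree part, so they agree on the closing edge.
    have hE : ∀ e : E, f e.1.1 e.1.2 = h e.1.2 - h e.1.1 := by
      intro e
      have h1 := h0 _ ⟨e, rfl⟩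
      have h2 := (c e).sum_coboundary h
      rw [closeWalk_sum] at h1 h2
      have h3 : ∑ i : Fin (p e).length, f ((p e).getVert i.val) ((p e).getVert (i.val + 1)) =
          ∑ i : Fin (p e).length, (h ((p e).getVert (i.val + 1)) - h ((p e).getVert i.val)) :=
        Finset.sum_congr rfl fun i _ => hh _ _ ((p e).adj_getVert_succ i.2)
      rw [h3, ← h2] at h1
      exact add_left_cancel h1
    refine ⟨h, fun x y hxy => ?_⟩
    by_cases e : x = y
    · rw [e, hf.self, sub_self]
    by_cases hxT : T.Adj x y
    · exact hh x y hxT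
    have hmk : s((Quot.out s(x, y)).1, (Quot.out s(x, y)).2) = s(x, y) := Quot.out_eq _
    rcases Sym2.eq_iff.1 hmk with ⟨h1, h2⟩ | ⟨h1, h2⟩
    · exact hE ⟨(x, y), ⟨e, hxy⟩, hxT, Prod.ext h1 h2⟩
    · have := hE ⟨(y, x), ⟨Ne.symm e, K.symm hxy⟩, fun h => hxT h.symm, by
        dsimp only
        rw [Sym2.eq_swap]
        exact Prod.ext h1 h2⟩
      rw [hf.neg_symm (K.symm hxy), this, neg_sub]
  · rintro _ ⟨e, rfl⟩
    exact closeWalk_isCycle hTK (hp e) e.2.1.2 e.2.1.1 e.2.2.1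

end ReflGraph

namespace ReflGraph

/-! ## Products with paths, and cycles -/

section Product

variable {W Q : Type*} [AddCommGroup Q] {K : ReflGraph W} {l : ℕ}

theorem path_adj_cases {k k' : Fin (l + 1)} (h : (path l).Adj k k') :
    k = k' ∨ (∃ i : Fin l, k = i.castSucc ∧ k' = i.succ) ∨
      ∃ i : Fin l, k = i.succ ∧ k' = i.castSucc := by
  obtain ⟨h1, h2⟩ := h
  obtain ⟨k, hk⟩ := k
  obtain ⟨k', hk'⟩ := k'
  simp only at h1 h2
  rcases lt_trichotomy k k' with h | h | h
  · exact Or.inr (Or.inl ⟨⟨k, by omega⟩, rfl, Fin.ext (by simp; omega)⟩)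
  · exact Or.inl (Fin.ext h)
  · exact Or.inr (Or.inr ⟨⟨k', by omega⟩, Fin.ext (by simp; omega), rfl⟩)

theorem path_adj_succ (i : Fin l) : (path l).Adj i.castSucc i.succ :=
  ⟨by simp; omega, by simp⟩

/-- A cocycle on a product with a path is a coboundary if it is one on the first slice. -/
theorem exists_potential_prod {f : Fin (l + 1) × W → Fin (l + 1) × W → Q}
    (hf : ((path l).prod K).IsCocycle f) {h₀ : W → Q}
    (hh₀ : ∀ x y, K.Adj x y → f (0, x) (0, y) = h₀ y - h₀ x) :
    ∃ h : Fin (l + 1) × W → Q, (∀ x, h (0, x) = h₀ x) ∧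
      ∀ a b, ((path l).prod K).Adj a b → f a b = h b - h a := by
  let H : Fin (l + 1) → W → Q := fun k => Fin.induction (motive := fun _ => W → Q) h₀
    (fun i Hi x => Hi x + f (i.castSucc, x) (i.succ, x)) k
  have H0 : H 0 = h₀ := Fin.induction_zero ..
  have HS : ∀ (i : Fin l) x, H i.succ x = H i.castSucc x + f (i.castSucc, x) (i.succ, x) := by
    intro i x
    simp only [H, Fin.induction_succ]
  -- `H` was defined by climbing the columns. In the categorical product each square has its
  -- diagonals, and the two triangles along one of them carry the identity from a slice to the next.
  have hor : ∀ k x y, K.Adj x y → f (k, x) (k, y) = H k y - H k x := by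
    intro k x y hxy
    induction k using Fin.induction with
    | zero => rw [H0]; exact hh₀ x y hxy
    | succ i ih =>
      have h1 := hf (x := (i.castSucc, x)) (y := (i.succ, x)) (z := (i.succ, y))
        ⟨path_adj_succ i, K.refl x⟩ ⟨(path l).refl _, hxy⟩ ⟨path_adj_succ i, hxy⟩
      have h2 := hf (x := (i.castSucc, x)) (y := (i.castSucc, y)) (z := (i.succ, y))
        ⟨(path l).refl _, hxy⟩ ⟨path_adj_succ i, K.refl y⟩ ⟨path_adj_succ i, hxy⟩
      rw [← h2, ih] at h1
      rw [HS, HS]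
      rw [← eq_sub_iff_add_eq'] at h1
      rw [h1]
      abel
  have hup : ∀ (i : Fin l) x y, K.Adj x y →
      f (i.castSucc, x) (i.succ, y) = H i.succ y - H i.castSucc x := by
    intro i x y hxy
    rw [← hf (x := (i.castSucc, x)) (y := (i.castSucc, y)) (z := (i.succ, y))
        ⟨(path l).refl _, hxy⟩ ⟨path_adj_succ i, K.refl y⟩ ⟨path_adj_succ i, hxy⟩,
      hor _ _ _ hxy, HS]
    abel
  refine ⟨fun a => H a.1 a.2, fun x => congrFun H0 x, ?_⟩
  rintro ⟨k, x⟩ ⟨k', y⟩ ⟨hk, hxy⟩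
  simp only at hk hxy
  rcases path_adj_cases hk with rfl | ⟨i, rfl, rfl⟩ | ⟨i, rfl, rfl⟩
  · exact hor _ _ _ hxy
  · exact hup i x y hxy
  · rw [hf.neg_symm (x := (i.castSucc, y)) (y := (i.succ, x)) ⟨path_adj_succ i, K.symm hxy⟩,
      hup i y x (K.symm hxy), neg_sub]

theorem cycle_adj_succ {n : ℕ} (x : ZMod n) : (cycle n).Adj x (x + 1) := Or.inr (Or.inl rfl)

/-- All slices of a path-of-cycles are homologous. -/
theorem sum_slice {n : ℕ} [NeZero n] {f : Fin (l + 1) × ZMod n → Fin (l + 1) × ZMod n → Q}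
    (hf : ((path l).prod (cycle n)).IsCocycle f) (k : Fin (l + 1)) :
    ∑ x, f (k, x) (k, x + 1) = ∑ x, f (0, x) (0, x + 1) := by
  induction k using Fin.induction with
  | zero => rfl
  | succ i ih =>
    rw [← ih, ← sub_eq_zero, ← Finset.sum_sub_distrib]
    -- Consecutive slices differ, edge by edge, by a difference of vertical edges, again by cutting
    -- squares along a diagonal; the sum around the cycle cancels by translation invariance.
    have h1 : ∀ x : ZMod n, f (i.succ, x) (i.succ, x + 1) - f (i.castSucc, x) (i.castSucc, x + 1) =
        f (i.castSucc, x + 1) (i.succ, x + 1) - f (i.castSucc, x) (i.succ, x) := by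
      intro x
      have h1 := hf (x := (i.castSucc, x)) (y := (i.succ, x)) (z := (i.succ, x + 1))
        ⟨path_adj_succ i, (cycle n).refl x⟩ ⟨(path l).refl _, cycle_adj_succ x⟩
        ⟨path_adj_succ i, cycle_adj_succ x⟩
      have h2 := hf (x := (i.castSucc, x)) (y := (i.castSucc, x + 1)) (z := (i.succ, x + 1))
        ⟨(path l).refl _, cycle_adj_succ x⟩ ⟨path_adj_succ i, (cycle n).refl (x + 1)⟩
        ⟨path_adj_succ i, cycle_adj_succ x⟩
      rw [← h2] at h1
      rw [sub_eq_sub_iff_add_eq_add, add_comm, h1, add_comm]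
    rw [Finset.sum_congr rfl fun x _ => h1 x, Finset.sum_sub_distrib, sub_eq_zero]
    exact Equiv.sum_comp (Equiv.addRight (1 : ZMod n))
      fun x => f (i.castSucc, x) (i.succ, x)

theorem sum_zmod {n : ℕ} [NeZero n] (F : ZMod n → Q) :
    ∑ x, F x = ∑ t ∈ Finset.range n, F (t : ZMod n) := by
  refine Finset.sum_nbij' ZMod.val (fun t => (t : ZMod n)) ?_ ?_ ?_ ?_ ?_
  · intro x _
    exact Finset.mem_range.2 (ZMod.val_lt x)
  · intro t _
    exact Finset.mem_univ _
  · intro x _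
    exact ZMod.natCast_zmod_val x
  · intro t ht
    exact ZMod.val_cast_of_lt (Finset.mem_range.1 ht)
  · intro x _
    rw [ZMod.natCast_zmod_val]

theorem sum_range_mul (m n : ℕ) (F : ℕ → Q) :
    ∑ t ∈ Finset.range (m * n), F t =
      ∑ i ∈ Finset.range m, ∑ j ∈ Finset.range n, F (i * n + j) := by
  induction m with
  | zero => simp
  | succ m ih => rw [Nat.succ_mul, Finset.sum_range_add, ih, Finset.sum_range_succ]

end Product

/-- A function on a cycle given by a sequence that closes up is a potential. -/
theorem cycle_coboundary {Q : Type*} [AddCommGroup Q] {n : ℕ} [NeZero n] {f : ZMod n → ZMod n → Q}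
    (hf : (cycle n).IsCocycle f) {Φ : ℕ → Q}
    (h : ∀ t < n, f (t : ZMod n) ((t + 1 : ℕ) : ZMod n) = Φ (t + 1) - Φ t) (hn : Φ n = Φ 0)
    {x y : ZMod n} (hxy : (cycle n).Adj x y) : f x y = Φ y.val - Φ x.val := by
  have key : ∀ x : ZMod n, f x (x + 1) = Φ (x + 1).val - Φ x.val := by
    intro x
    have h1 := h x.val (ZMod.val_lt x)
    rw [Nat.cast_add, ZMod.natCast_zmod_val, Nat.cast_one] at h1
    rw [h1]
    congr 1
    have e : (x + 1).val = (x.val + 1) % n := by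
      rw [← ZMod.val_natCast, Nat.cast_add, ZMod.natCast_zmod_val, Nat.cast_one]
    rcases (Nat.succ_le_of_lt (ZMod.val_lt x)).lt_or_eq with hlt | heq
    · rw [e, Nat.mod_eq_of_lt hlt]
    · rw [e, show x.val + 1 = n from heq, Nat.mod_self, hn]
  rcases hxy with rfl | rfl | rfl
  · rw [hf.self, sub_self]
  · exact key x
  · rw [hf.neg_symm (cycle_adj_succ y), key, neg_sub]

end ReflGraph

/-! ## Cocycles on the sum gadget -/

namespace SumGadget

open ReflGraph

variable {s l g : ℕ}

/-- The path-of-cycles in the gadget. -/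
def bodyHom (s l g : ℕ) : ((path l).prod (cycle (s * g))).Hom (graph s l g) where
  toFun a := body a.1 a.2
  map_adj h := body_adj h.1 h.2

/-- The vertex `(b, x)` of the `i`-th copy of `P_1 × Z`. -/
def collarVertex (i : Fin s) (a : Fin 2 × ZMod g) : Vertex s l g := Quot.mk _ (Sum.inr ⟨i, a⟩)

/-- The `i`-th copy of `P_1 × Z` in the gadget. -/
def collarHom (l : ℕ) (i : Fin s) : ((path 1).prod (cycle g)).Hom (graph s l g) where
  toFun := collarVertex i
  map_adj {x y} h := ⟨_, _, rfl, rfl, Or.inr ⟨_, _, rfl, rfl, i, x, y, rfl, rfl, h⟩⟩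

theorem body_first (i i' : Fin s) :
    (body 0 ((i.val * g : ℕ) : ZMod (s * g)) : Vertex s l g) = body 0 ((i'.val * g : ℕ)) :=
  Quot.sound (Glue.first i i')

/-- The bound includes `j = g` so that the closing edge of $A'_i$ is covered: the end of the `i`-th
arc is the start of the next one (of arc $0$ for the last), and all these starts are the one shared
vertex. -/
theorem collar_eq_body [NeZero g] (i : Fin s) {j : ℕ} (hj : j ≤ g) :
    (collarVertex i (0, (j : ZMod g)) : Vertex s l g) =
      body 0 ((i.val * g + j : ℕ) : ZMod (s * g)) := by
  have hlt : ∀ j < g, (collarVertex i (0, (j : ZMod g)) : Vertex s l g) =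
      body 0 ((i.val * g + j : ℕ) : ZMod (s * g)) := fun j hj =>
    Quot.sound (Glue.collar i ⟨j, hj⟩)
  rcases hj.lt_or_eq with hj | rfl
  · exact hlt j hj
  · have h0 := hlt 0 (NeZero.pos j)
    simp only [Nat.cast_zero, Nat.add_zero] at h0
    rw [ZMod.natCast_self, h0]
    rcases (Nat.succ_le_of_lt i.2).lt_or_eq with h | h
    · rw [show i.val * j + j = (⟨i.val + 1, h⟩ : Fin s).val * j by simp [Nat.succ_mul]]
      exact body_first i _
    · rw [show i.val * j + j = s * j from (Nat.succ_mul _ _).symm.trans (congrArg (· * j) h), ZMod.natCast_self]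
      simpa using body_first (l := l) (g := j) i ⟨0, i.pos⟩

variable {Q : Type*} [AddCommGroup Q] {f : Vertex s l g → Vertex s l g → Q}

/-- The collar makes $A_i$ homologous to $A'_i$, and $A'_i$ is the `i`-th arc of the first slice. -/
theorem arm_sum [NeZero g] (hf : (graph s l g).IsCocycle f) (i : Fin s) :
    (arm i).sum f = ∑ t ∈ Finset.range g, f (body 0 ((i.val * g + t : ℕ) : ZMod (s * g)))
      (body 0 ((i.val * g + t + 1 : ℕ) : ZMod (s * g))) := by
  have h1 := sum_slice (hf.comp (collarHom l i)) 1
  rw [sum_zmod, sum_zmod] at h1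
  have h2 : (arm i).sum f = ∑ t ∈ Finset.range g, f (collarVertex i (1, (t : ZMod g)))
      (collarVertex i (1, (t : ZMod g) + 1)) := by
    rw [← Fin.sum_univ_eq_sum_range fun t => f (collarVertex i (1, (t : ZMod g)))
      (collarVertex i (1, (t : ZMod g) + 1))]
    refine Finset.sum_congr rfl fun j _ => ?_
    change f (collarVertex i (1, ((j.val : ℕ) : ZMod g)))
      (collarVertex i (1, ((j.val + 1 : ℕ) : ZMod g))) = _
    rw [Nat.cast_succ]
  refine h2.trans (h1.trans (Finset.sum_congr rfl fun t ht => ?_))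
  have ht := Finset.mem_range.1 ht
  change f (collarVertex i (0, (t : ZMod g))) (collarVertex i (0, (t : ZMod g) + 1)) = _
  rw [← Nat.cast_succ, collar_eq_body i ht.le, collar_eq_body i ht]
  rfl

theorem body_last (hs : 0 < s) {i j : ℕ} (hi : i < s) (hj : j < g) :
    (body (Fin.last l) ((j * s + i : ℕ) : ZMod (s * g)) : Vertex s l g) = endVertex j := by
  have := Quot.sound (Glue.last (l := l) (⟨i, hi⟩ : Fin s) ⟨0, hs⟩ ⟨j, hj⟩)
  simpa [endVertex, body, add_comm] using this

/-- Of any `s` consecutive edges in a block of the last slice, the first `s - 1` become loops, on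
which a cocycle vanishes, and the last one becomes an edge of $Z$. -/
theorem endCycle_sum [NeZero s] [NeZero g] (hf : (graph s l g).IsCocycle f) :
    endCycle.sum f = ∑ t ∈ Finset.range (s * g), f (body (Fin.last l) (t : ZMod (s * g)))
      (body (Fin.last l) ((t + 1 : ℕ) : ZMod (s * g))) := by
  have hs := NeZero.pos s
  rw [show Finset.range (s * g) = Finset.range (g * s) by rw [mul_comm], sum_range_mul]
  change ∑ j : Fin g, f (endVertex j.val) (endVertex (j.val + 1)) = _
  rw [Fin.sum_univ_eq_sum_range fun j => f (endVertex j) (endVertex (j + 1))]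
  refine Finset.sum_congr rfl fun j hj => ?_
  have hj := Finset.mem_range.1 hj
  have hs' : s = s - 1 + 1 := by omega
  rw [show Finset.range s = Finset.range (s - 1 + 1) by rw [← hs'], Finset.sum_range_succ,
    Finset.sum_eq_zero, zero_add, body_last hs (by omega) hj]
  · congr 1
    rw [show j * s + (s - 1) + 1 = (j + 1) * s by rw [Nat.succ_mul]; omega]
    rfl
  · intro i hi
    have hi := Finset.mem_range.1 hi
    rw [body_last hs (by omega) hj, add_assoc, body_last hs (by omega) hj, hf.self]

/-- In the gadget, the class of `Z` is the sum of the classes of the `A_i`. -/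
theorem endCycle_sum_eq [NeZero s] [NeZero g] (hf : (graph s l g).IsCocycle f) :
    endCycle.sum f = ∑ i : Fin s, (arm i).sum f := by
  have h1 := sum_slice (hf.comp (bodyHom s l g)) (Fin.last l)
  rw [sum_zmod, sum_zmod] at h1
  simp only [arm_sum hf, endCycle_sum hf]
  rw [Fin.sum_univ_eq_sum_range fun i => ∑ t ∈ Finset.range g,
    f (body 0 ((i * g + t : ℕ) : ZMod (s * g))) (body 0 ((i * g + t + 1 : ℕ) : ZMod (s * g)))]
  rw [← sum_range_mul s g fun t => f (body 0 (t : ZMod (s * g))) (body 0 ((t + 1 : ℕ) : ZMod (s * g)))]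
  simpa [bodyHom] using h1

/-- A cocycle that vanishes on the `A_i` is a coboundary. -/
theorem exists_potential [NeZero s] [NeZero g] (hf : (graph s l g).IsCocycle f)
    (h0 : ∀ i, (arm i).sum f = 0) :
    ∃ h : Vertex s l g → Q, ∀ x y, (graph s l g).Adj x y → f x y = h y - h x := by
  let e : ℕ → Q := fun t => f (body 0 (t : ZMod (s * g))) (body 0 ((t + 1 : ℕ) : ZMod (s * g)))
  -- The potential on the first slice. It vanishes at all multiples of `g`, because each arc sums to
  -- the value on an arm; so it closes up and is compatible with the identified vertices. It is then
  -- extended over the body and over each collar.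
  let Φ : ℕ → Q := fun n => ∑ t ∈ Finset.range n, e t
  have hΦ : ∀ t, e t = Φ (t + 1) - Φ t := fun t => by simp [Φ, Finset.sum_range_succ]
  have hΦ0 : ∀ i ≤ s, Φ (i * g) = 0 := by
    intro i hi
    change ∑ t ∈ Finset.range (i * g), e t = 0
    rw [sum_range_mul]
    refine Finset.sum_eq_zero fun i' hi' => ?_
    have := h0 ⟨i', (Finset.mem_range.1 hi').trans_le hi⟩
    rwa [arm_sum hf] at this
  have hval : ∀ n ≤ s * g, Φ ((n : ZMod (s * g)).val) = Φ n := by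
    intro n hn
    rcases hn.lt_or_eq with h | rfl
    · rw [ZMod.val_cast_of_lt h]
    · rw [ZMod.natCast_self, ZMod.val_zero, hΦ0 s le_rfl]
      rfl
  obtain ⟨hB, hB0, hB1⟩ := exists_potential_prod (hf.comp (bodyHom s l g))
    (h₀ := fun x => Φ x.val) fun x y hxy => by
      have hc : (cycle (s * g)).IsCocycle
          fun x y : ZMod (s * g) => f (body 0 x) (body 0 y) := fun x y z h h' h'' =>
        hf (body_adj ((path l).refl 0) h) (body_adj ((path l).refl 0) h')
          (body_adj ((path l).refl 0) h'')
      exact cycle_coboundary hc (fun t _ => hΦ t) (hΦ0 s le_rfl) hxy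
  have hC : ∀ i : Fin s, ∃ h : Fin 2 × ZMod g → Q, (∀ x, h (0, x) = Φ (i.val * g + x.val)) ∧
      ∀ a b, ((path 1).prod (cycle g)).Adj a b →
        f (collarVertex i a) (collarVertex i b) = h b - h a := by
    intro i
    refine exists_potential_prod (hf.comp (collarHom l i)) fun x y hxy => ?_
    have hc : (cycle g).IsCocycle
        fun x y : ZMod g => f (collarVertex i (0, x)) (collarVertex i (0, y)) :=
      fun x y z h h' h'' => hf ((collarHom l i).map_adj ⟨(path 1).refl 0, h⟩)
        ((collarHom l i).map_adj ⟨(path 1).refl 0, h'⟩)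
        ((collarHom l i).map_adj ⟨(path 1).refl 0, h''⟩)
    refine cycle_coboundary hc (Φ := fun n => Φ (i.val * g + n)) (fun t ht => ?_) ?_ hxy
    · rw [collar_eq_body i ht.le, collar_eq_body i ht]
      exact hΦ _
    · simp only [add_zero]
      rw [← Nat.succ_mul, hΦ0 _ i.2, hΦ0 _ i.2.le]
  choose hC hC0 hC1 using hC
  have hs := NeZero.pos s
  -- Identified vertices of the last slice are joined by edges that become loops, so the potential
  -- cannot change between them.
  have hlast : ∀ (i : ℕ) (j : Fin g), i < s →
      hB (Fin.last l, ((i + j.val * s : ℕ) : ZMod (s * g))) =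
        hB (Fin.last l, ((j.val * s : ℕ) : ZMod (s * g))) := by
    intro i j hi
    induction i with
    | zero => rw [zero_add]
    | succ i ih =>
      rw [← ih (by omega)]
      have h1 := hB1 (Fin.last l, ((i + j.val * s : ℕ) : ZMod (s * g)))
        (Fin.last l, ((i + 1 + j.val * s : ℕ) : ZMod (s * g)))
        ⟨(path l).refl _, Or.inr (Or.inl (by push_cast; ring))⟩
      have h2 : f (body (Fin.last l) ((i + j.val * s : ℕ) : ZMod (s * g)))
          (body (Fin.last l) ((i + 1 + j.val * s : ℕ) : ZMod (s * g))) = 0 := by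
        rw [add_comm i, add_comm (i + 1), body_last hs (by omega) j.2, body_last hs hi j.2, hf.self]
      exact sub_eq_zero.1 (h1.symm.trans h2)
  have hbound : ∀ (i : Fin s) (j : ℕ), j < g → i.val * g + j ≤ s * g := by
    intro i j hj
    have : (i.val + 1) * g ≤ s * g := Nat.mul_le_mul_right g i.2
    rw [Nat.succ_mul] at this
    omega
  refine ⟨Quot.lift (Sum.elim hB fun p => hC p.1 p.2) ?_, ?_⟩
  · rintro _ _ (⟨i, i', j⟩ | ⟨i, i'⟩ | ⟨i, j⟩)
    · exact (hlast i j i.2).trans (hlast i' j i'.2).symm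
    · simp only [Sum.elim_inl, hB0]
      rw [hval _ (Nat.mul_le_mul_right g i.2.le), hval _ (Nat.mul_le_mul_right g i'.2.le),
        hΦ0 _ i.2.le, hΦ0 _ i'.2.le]
    · simp only [Sum.elim_inl, Sum.elim_inr, hB0, hC0]
      rw [hval _ (hbound i j j.2), ZMod.val_cast_of_lt j.2]
  · rintro _ _ ⟨_, _, rfl, rfl, ⟨a, b, rfl, rfl, h⟩ | ⟨_, _, rfl, rfl, i, a, b, rfl, rfl, h⟩⟩
    · exact hB1 a b h
    · exact hC1 i a b h

end SumGadget

/-! ## Arithmetic of cycles -/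

namespace ReflGraph

section Step

variable {g : ℕ}

/-- The cocycle that counts the signed steps in a cycle. -/
def cycStep (x y : ZMod g) : ℤ := if y = x + 1 then 1 else if x = y + 1 then -1 else 0

theorem natCast_ne_zero {m : ℕ} (h0 : 0 < m) (hm : m < g) : (m : ZMod g) ≠ 0 := by
  rw [Ne, ZMod.natCast_eq_zero_iff]
  exact fun h => absurd (Nat.le_of_dvd h0 h) (by omega)

/-- As $1,2,3\ne0$ modulo `g`, the two directions of a step are distinct and three pairwise adjacent
vertices are never all different. -/
theorem isCocycle_cycStep (hg : 4 ≤ g) : (cycle g).IsCocycle (cycStep (g := g)) := by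
  have h1 : (1 : ZMod g) ≠ 0 := by
    simpa using natCast_ne_zero (g := g) (m := 1) (by omega) (by omega)
  have h2 : (2 : ZMod g) ≠ 0 := by
    simpa using natCast_ne_zero (g := g) (m := 2) (by omega) (by omega)
  have h3 : (3 : ZMod g) ≠ 0 := by
    simpa using natCast_ne_zero (g := g) (m := 3) (by omega) (by omega)
  intro x y z hxy hyz hxz
  simp only [cycle] at hxy hyz hxz
  unfold cycStep
  grind

theorem cycStep_self (hg : 4 ≤ g) (x : ZMod g) : cycStep x x = 0 :=
  (isCocycle_cycStep hg).self x

theorem cycStep_succ (x : ZMod g) : cycStep x (x + 1) = 1 := by simp [cycStep]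

theorem cycStep_mul (hg : 4 ≤ g) {σ : ℤ} (hσ : σ = 1 ∨ σ = -1) (x y : ZMod g) :
    cycStep ((σ : ZMod g) * x) ((σ : ZMod g) * y) = σ * cycStep x y := by
  have h2 : (2 : ZMod g) ≠ 0 := by
    simpa using natCast_ne_zero (g := g) (m := 2) (by omega) (by omega)
  rcases hσ with rfl | rfl
  · simp
  · simp only [Int.cast_neg, Int.cast_one, neg_one_mul]
    unfold cycStep
    grind

theorem cycle_adj_mul {σ : ℤ} (hσ : σ = 1 ∨ σ = -1) {x y : ZMod g} (h : (cycle g).Adj x y) :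
    (cycle g).Adj ((σ : ZMod g) * x) ((σ : ZMod g) * y) := by
  rcases hσ with rfl | rfl
  · simpa using h
  · simp only [Int.cast_neg, Int.cast_one, neg_one_mul]
    simp only [cycle] at h ⊢
    grind

/-- Adjacency in a cycle, in terms of the representatives `0, …, n - 1`. -/
def NatAdj (n x y : ℕ) : Prop :=
  x = y ∨ ((y = x + 1 ∧ y < n) ∨ (x + 1 = n ∧ y = 0)) ∨
    ((x = y + 1 ∧ x < n) ∨ (y + 1 = n ∧ x = 0))

theorem NatAdj.symm {n x y : ℕ} (h : NatAdj n x y) : NatAdj n y x := by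
  rcases h with h | h | h
  · exact Or.inl h.symm
  · exact Or.inr (Or.inr h)
  · exact Or.inr (Or.inl h)

theorem natAdj_val {n : ℕ} [NeZero n] {x y : ZMod n} (h : (cycle n).Adj x y) :
    NatAdj n x.val y.val := by
  have e : ∀ x : ZMod n, ((x + 1).val = x.val + 1 ∧ (x + 1).val < n) ∨
      (x.val + 1 = n ∧ (x + 1).val = 0) := by
    intro x
    have e : (x + 1).val = (x.val + 1) % n := by
      rw [← ZMod.val_natCast, Nat.cast_add, ZMod.natCast_zmod_val, Nat.cast_one]
    rcases (Nat.succ_le_of_lt (ZMod.val_lt x)).lt_or_eq with hlt | heq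
    · exact Or.inl ⟨by rw [e, Nat.mod_eq_of_lt hlt], ZMod.val_lt _⟩
    · exact Or.inr ⟨heq, by rw [e, show x.val + 1 = n from heq, Nat.mod_self]⟩
  rcases h with rfl | rfl | rfl
  · exact Or.inl rfl
  · exact Or.inr (Or.inl (e x))
  · exact Or.inr (Or.inr (e y))

/-- The map from the cycle of length `s * g` to the cycle of length `g` that wraps the `k`-th of the
arcs of length `g` around it, and that is constant on the others. -/
def arcMap (g k x : ℕ) : ZMod g := if x / g = k then (x : ZMod g) else 0

theorem div_eq_iff_arc (hg : 0 < g) {x k : ℕ} : x / g = k ↔ k * g ≤ x ∧ x < k * g + g := by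
  rw [Nat.div_eq_iff hg]
  constructor <;> rintro ⟨h1, h2⟩ <;> constructor <;> omega

/-- The arc map advances exactly when the step starts in the `k`-th arc; at both ends of the arc its
value is $0$ modulo `g`, which matches the constant outside. -/
theorem arcMap_step {s k x y : ℕ} (hg : 0 < g)
    (h : (y = x + 1 ∧ y < s * g) ∨ (x + 1 = s * g ∧ y = 0)) :
    arcMap g k y = arcMap g k x + if x / g = k then 1 else 0 := by
  have key : ∀ m : ℕ, x + 1 = m * g → ((x : ZMod g) + 1 = 0) := by
    intro m hm
    have : ((x + 1 : ℕ) : ZMod g) = ((m * g : ℕ) : ZMod g) := by rw [hm]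
    simpa using this
  rcases h with ⟨rfl, h⟩ | ⟨h, rfl⟩
  · unfold arcMap
    by_cases h1 : x / g = k <;> by_cases h2 : (x + 1) / g = k
    · simp [h1, h2]
    · simp only [h1, h2, if_true, if_false]
      rw [div_eq_iff_arc hg] at h1 h2
      rw [key (k + 1) (by rw [Nat.succ_mul]; omega)]
    · simp only [h1, h2, if_true, if_false]
      rw [div_eq_iff_arc hg] at h1 h2
      rw [Nat.cast_succ, key k (by omega), add_zero]
    · simp [h1, h2]
  · unfold arcMap
    have h0 : (if 0 / g = k then ((0 : ℕ) : ZMod g) else 0) = 0 := by simp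
    rw [h0]
    split_ifs
    · exact (key s h).symm
    · simp

/-- The quotient advances exactly at the end of a block of `s`; at the wraparound it has reached
`g`, which is $0$. -/
theorem div_step {s x y : ℕ} (hs : 0 < s)
    (h : (y = x + 1 ∧ y < s * g) ∨ (x + 1 = s * g ∧ y = 0)) :
    ((y / s : ℕ) : ZMod g) = ((x / s : ℕ) : ZMod g) + if s ∣ x + 1 then 1 else 0 := by
  rcases h with ⟨rfl, h⟩ | ⟨h, rfl⟩
  · rw [Nat.succ_div]
    split_ifs <;> simp
  · have h1 : (x + 1) / s = g := by rw [h, Nat.mul_div_cancel_left _ hs]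
    have h2 : s ∣ x + 1 := ⟨g, h⟩
    rw [Nat.succ_div, if_pos h2] at h1
    have h3 : (((x / s + 1 : ℕ)) : ZMod g) = 0 := by rw [h1, ZMod.natCast_self]
    rw [if_pos h2, ← Nat.cast_succ, h3]
    simp

theorem adj_add_ite {x : ZMod g} {p : Prop} [Decidable p] :
    (cycle g).Adj x (x + if p then 1 else 0) := by
  split_ifs
  · exact Or.inr (Or.inl rfl)
  · exact Or.inl (add_zero x).symm

theorem cycStep_add_ite (hg : 4 ≤ g) {x : ZMod g} {p : Prop} [Decidable p] :
    cycStep x (x + if p then 1 else 0) = if p then 1 else 0 := by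
  split_ifs
  · exact cycStep_succ x
  · rw [add_zero, cycStep_self hg]

theorem arcMap_adj {s k x y : ℕ} (hg : 0 < g) (h : NatAdj (s * g) x y) :
    (cycle g).Adj (arcMap g k x) (arcMap g k y) := by
  rcases h with rfl | h | h
  · exact (cycle g).refl _
  · rw [arcMap_step hg h]
    exact adj_add_ite
  · rw [arcMap_step hg h]
    exact (cycle g).symm adj_add_ite

theorem div_adj {s x y : ℕ} (hs : 0 < s) (h : NatAdj (s * g) x y) :
    (cycle g).Adj ((x / s : ℕ) : ZMod g) ((y / s : ℕ) : ZMod g) := by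
  rcases h with rfl | h | h
  · exact (cycle g).refl _
  · rw [div_step hs h]
    exact adj_add_ite
  · rw [div_step hs h]
    exact (cycle g).symm adj_add_ite

/-- The potential by which the two maps of the long cycle differ. -/
def arcPotential (s g k x : ℕ) : ℤ := (min (x - k * g) g : ℕ) - (x / s : ℕ)

/-- Each of the maps `arcMap g k` is homotopic to the map `x ↦ x / s`. -/
theorem cycStep_arcMap (hg : 4 ≤ g) {s k x y : ℕ} (hk : k < s) (h : NatAdj (s * g) x y) :
    cycStep (arcMap g k x) (arcMap g k y) =
      cycStep ((x / s : ℕ) : ZMod g) ((y / s : ℕ) : ZMod g) +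
        (arcPotential s g k y - arcPotential s g k x) := by
  have hg0 : 0 < g := by omega
  have hs : 0 < s := by omega
  have key : ∀ {x y : ℕ}, (y = x + 1 ∧ y < s * g) ∨ (x + 1 = s * g ∧ y = 0) →
      cycStep (arcMap g k x) (arcMap g k y) =
        cycStep ((x / s : ℕ) : ZMod g) ((y / s : ℕ) : ZMod g) +
          (arcPotential s g k y - arcPotential s g k x) := by
    intro x y h
    rw [arcMap_step hg0 h, div_step hs h, cycStep_add_ite hg, cycStep_add_ite hg]
    -- With truncated subtraction, `min (x - k * g) g` is the integer lift of the arc map, and `x /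
    -- s` that of the other map. Both lifts rise from $0$ to `g` in one turn, so their difference
    -- closes up.
    unfold arcPotential
    rcases h with ⟨rfl, h⟩ | ⟨h, rfl⟩
    · rw [Nat.succ_div]
      simp only [div_eq_iff_arc hg0]
      split_ifs <;> push_cast <;> omega
    · have h1 : (x + 1) / s = g := by rw [h, Nat.mul_div_cancel_left _ hs]
      have h2 : s ∣ x + 1 := ⟨g, h⟩
      rw [Nat.succ_div, if_pos h2] at h1
      rw [if_pos h2]
      simp only [div_eq_iff_arc hg0]
      have h3 : k * g + g ≤ s * g := by
        rw [← Nat.succ_mul]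
        exact Nat.mul_le_mul_right g hk
      have h4 : k * g + g = s * g ∨ k * g + g + g ≤ s * g := by
        rcases (Nat.succ_le_of_lt hk).lt_or_eq with h | h
        · right
          have := Nat.mul_le_mul_right g (Nat.succ_le_of_lt h)
          simp only [Nat.succ_mul] at this
          exact this
        · left
          rw [← h, Nat.succ_mul]
      have h5 : 0 / s = 0 := Nat.zero_div s
      rw [h5]
      split_ifs <;> omega
  rcases h with rfl | h | h
  · rw [cycStep_self hg, cycStep_self hg, sub_self, add_zero]
  · exact key h
  · have h' : NatAdj (s * g) y x := Or.inr (Or.inl h)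
    rw [(isCocycle_cycStep hg).neg_symm (arcMap_adj hg0 h'),
      (isCocycle_cycStep hg).neg_symm (div_adj hs h'), key h]
    ring

end Step

end ReflGraph

namespace Prelim

open ReflGraph

variable {V : Type*} {G : SimpleGraph V}

/-! ## Labels of vertices -/

/-- The cycle `A^v_i` to which the `k`-th arm of a gadget is attached. -/
def Gadget.armOf (o : EdgeOrder G) : Gadget G → ℕ → V × Fin 3
  | atVertex v, k => (v, Fin.ofNat 3 k)
  | atPair v i j _, k => (v, if k = 0 then i else j)
  | atEdge e i, k => (if k = 0 then o.fst e else o.snd e, i)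

/-- The sign with which the `k`-th arm of a gadget is attached. -/
def Gadget.sign : Gadget G → ℕ → ℤ
  | atPair _ _ _ _, k => if k = 0 then 1 else -1
  | _, _ => 1

theorem Gadget.sign_eq (γ : Gadget G) (k : ℕ) : γ.sign k = 1 ∨ γ.sign k = -1 := by
  cases γ <;> simp [sign, em]

theorem Gadget.sign_mul_self (γ : Gadget G) (k : ℕ) : γ.sign k * γ.sign k = 1 := by
  rcases γ.sign_eq k with h | h <;> simp [h]

/-- Different arms of one gadget go to different cycles: `i < j` for pairs, and `G` is loopless for
edges. Hence the label of an arm vertex determines the arm within the gadget. -/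
theorem Gadget.armOf_injective (o : EdgeOrder G) (γ : Gadget G) {k k' : ℕ} (hk : k < γ.size)
    (hk' : k' < γ.size) (h : γ.armOf o k = γ.armOf o k') : k = k' := by
  cases γ with
  | atVertex v =>
    simp only [size] at hk hk'
    simp only [armOf, Prod.mk.injEq, true_and] at h
    have := congrArg Fin.val h
    simp only [Fin.val_ofNat] at this
    omega
  | atPair v i j hij =>
    simp only [size] at hk hk'
    have h01 := hij.ne
    simp only [armOf, Prod.mk.injEq, true_and] at h
    by_cases h0 : k = 0 <;> by_cases h0' : k' = 0
    · omega
    · simp [h0, h0'] at h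
      exact absurd h h01
    · simp [h0, h0'] at h
      exact absurd h.symm h01
    · omega
  | atEdge e i =>
    simp only [size] at hk hk'
    have hne : o.fst e ≠ o.snd e := by
      have h1 := e.2
      rw [← o.mk_eq e, SimpleGraph.mem_edgeSet] at h1
      exact h1.ne
    simp only [armOf, Prod.mk.injEq, and_true] at h
    by_cases h0 : k = 0 <;> by_cases h0' : k' = 0
    · omega
    · simp [h0, h0'] at h
      exact absurd h hne
    · simp [h0, h0'] at h
      exact absurd h.symm hne
    · omega

theorem Gadget.size_pos (γ : Gadget G) : 0 < γ.size := by
  cases γ <;> simp [size]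

/-- Labels of the vertices of the first-stage graph: vertices of `Z^*` and of the `A^v_i`, vertices
of the first slice of a gadget (with their positions in the `A'_k`), vertices of the slices between
the first and the last one, and vertices of the last slice. -/
inductive Label (G : SimpleGraph V) (g : ℕ) : Type _
  | star (j : ZMod g) : Label G g
  | arm (a : V × Fin 3) (j : ZMod g) : Label G g
  | first (γ : Gadget G) (p : ℕ → ZMod g) : Label G g
  | mid (γ : Gadget G) (x : ℕ) : Label G g
  | last (γ : Gadget G) (j : ZMod g) : Label G g

namespace Label

variable {g : ℕ} (o : EdgeOrder G)

/-- The label of a vertex of the last slice of a gadget. -/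
def ofLast : Gadget G → ZMod g → Label G g
  | .atVertex _, j => star j
  | γ, j => last γ j

/-- The gadget to which a label belongs, if there is just one. -/
def owner : Label G g → Option (Gadget G)
  | star _ => none
  | arm _ _ => none
  | first γ _ => some γ
  | mid γ _ => some γ
  | last γ _ => some γ

/-- The labels of a gadget without its last slice. -/
def Near (γ : Gadget G) : Label G g → Prop
  | arm a _ => ∃ k < γ.size, γ.armOf o k = a
  | first γ' _ => γ' = γ
  | mid γ' _ => γ' = γ
  | _ => False

/-- The labels of a gadget without its first slice and arms. -/
def Far (γ : Gadget G) : Label G g → Prop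
  | star _ => ∃ v, γ = .atVertex v
  | mid γ' _ => γ' = γ
  | last γ' _ => γ' = γ
  | _ => False

open Classical in
/-- The position in `A_k`. -/
noncomputable def nearPos (γ : Gadget G) (k : ℕ) : Label G g → ZMod g
  | arm a j => if γ.armOf o k = a then (γ.sign k : ZMod g) * j else 0
  | first _ p => p k
  | mid _ x => arcMap g k x
  | _ => 0

/-- The position in `Z`. -/
def farPos : Label G g → ZMod g
  | star j => j
  | mid γ x => ((x / γ.size : ℕ) : ZMod g)
  | last _ j => j
  | _ => 0

/-- A relation that holds for the labels of adjacent vertices. -/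
structure Adj (X Y : Label G g) : Prop where
  zone : ∃ γ, (Near o γ X ∧ Near o γ Y) ∨ (Far γ X ∧ Far γ Y)
  near : ∀ γ, ∀ k < γ.size, Near o γ X → Near o γ Y → (cycle g).Adj (nearPos o γ k X) (nearPos o γ k Y)
  far : ∀ γ, Far γ X → Far γ Y → (cycle g).Adj (farPos X) (farPos Y)
  arm : ∀ a j a' j', X = .arm a j → Y = .arm a' j' → a = a'
  mid : ∀ γ x γ' x', X = .mid γ x → Y = .mid γ' x' → NatAdj (γ.size * g) x x'

variable {o}

theorem Adj.symm {X Y : Label G g} (h : Adj o X Y) : Adj o Y X where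
  zone := by
    obtain ⟨γ, h⟩ := h.zone
    exact ⟨γ, h.imp And.symm And.symm⟩
  near γ k hk hY hX := (cycle g).symm (h.near γ k hk hX hY)
  far γ hY hX := (cycle g).symm (h.far γ hX hY)
  arm a j a' j' hY hX := (h.arm a' j' a j hX hY).symm
  mid γ x γ' x' hY hX := by
    have e : γ' = γ := by
      obtain ⟨γ₀, h⟩ := h.zone
      subst hX hY
      rcases h with ⟨h1, h2⟩ | ⟨h1, h2⟩ <;> exact Eq.trans h1 h2.symm
    rw [← e]
    exact (h.mid γ' x' γ x hX hY).symm

theorem far_ofLast (γ : Gadget G) (j : ZMod g) : Far γ (ofLast γ j) := by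
  cases γ with
  | atVertex v => exact ⟨v, rfl⟩
  | atPair => exact rfl
  | atEdge => exact rfl

theorem not_near_ofLast (γ γ' : Gadget G) (j : ZMod g) : ¬ Near o γ' (ofLast γ j) := by
  cases γ <;> exact id

@[simp]
theorem farPos_ofLast (γ : Gadget G) (j : ZMod g) : farPos (ofLast γ j) = j := by
  cases γ <;> rfl

theorem ofLast_ne_arm (γ : Gadget G) (j : ZMod g) (a : V × Fin 3) (j' : ZMod g) :
    ofLast γ j ≠ .arm a j' := by
  cases γ <;> simp [ofLast]

theorem ofLast_ne_mid (γ : Gadget G) (j : ZMod g) (γ' : Gadget G) (x : ℕ) :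
    ofLast γ j ≠ .mid γ' x := by
  cases γ <;> simp [ofLast]

theorem adj_ofLast (γ : Gadget G) {j j' : ZMod g} (h : (cycle g).Adj j j') :
    Adj o (ofLast γ j) (ofLast γ j') where
  zone := ⟨γ, Or.inr ⟨far_ofLast γ j, far_ofLast γ j'⟩⟩
  near _ _ _ h _ := (not_near_ofLast _ _ _ h).elim
  far _ _ _ := by simpa using h
  arm _ _ _ _ h _ := (ofLast_ne_arm _ _ _ _ h).elim
  mid _ _ _ _ h _ := (ofLast_ne_mid _ _ _ _ h).elim

theorem adj_mid_ofLast (γ : Gadget G) {x : ℕ} {j : ZMod g}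
    (h : (cycle g).Adj ((x / γ.size : ℕ) : ZMod g) j) :
    Adj o (.mid γ x) (ofLast γ j) where
  zone := ⟨γ, Or.inr ⟨rfl, far_ofLast γ j⟩⟩
  near _ _ _ _ h := (not_near_ofLast _ _ _ h).elim
  far _ _ _ := by
    rw [farPos_ofLast]
    exact h
  arm _ _ _ _ _ h := (ofLast_ne_arm _ _ _ _ h).elim
  mid _ _ _ _ _ h := (ofLast_ne_mid _ _ _ _ h).elim

theorem adj_mid (hg : 0 < g) (γ : Gadget G) {x x' : ℕ} (h : NatAdj (γ.size * g) x x') :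
    Adj o (.mid γ x : Label G g) (.mid γ x') where
  zone := ⟨γ, Or.inr ⟨rfl, rfl⟩⟩
  near _ _ _ _ _ := arcMap_adj hg h
  far _ _ _ := div_adj γ.size_pos h
  arm := by simp
  mid γ₁ _ _ _ h1 h2 := by
    injection h1 with h1 h1'
    injection h2 with h2 h2'
    subst h1 h1' h2'
    exact h

theorem adj_first_mid (γ : Gadget G) {p : ℕ → ZMod g} {x : ℕ}
    (h : ∀ k, (cycle g).Adj (p k) (arcMap g k x)) : Adj o (.first γ p) (.mid γ x) where
  zone := ⟨γ, Or.inl ⟨rfl, rfl⟩⟩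
  near _ k _ _ _ := h k
  far _ h _ := h.elim
  arm := by simp
  mid := by simp

theorem adj_first (γ : Gadget G) {p p' : ℕ → ZMod g}
    (h : ∀ k, (cycle g).Adj (p k) (p' k)) : Adj o (.first γ p) (.first γ p') where
  zone := ⟨γ, Or.inl ⟨rfl, rfl⟩⟩
  near _ k _ _ _ := h k
  far _ h _ := h.elim
  arm := by simp
  mid := by simp

theorem adj_arm (a : V × Fin 3) {j j' : ZMod g} (h : (cycle g).Adj j j') :
    Adj o (.arm a j) (.arm a j') where
  zone := by
    refine ⟨.atVertex a.1, Or.inl ?_⟩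
    have : Near o (.atVertex a.1) (.arm a j : Label G g) :=
      ⟨a.2, a.2.2, Prod.ext rfl (by simp [Gadget.armOf])⟩
    exact ⟨this, this⟩
  near γ k _ _ _ := by
    simp only [nearPos]
    split_ifs
    · exact cycle_adj_mul (γ.sign_eq k) h
    · exact (cycle g).refl 0
  far _ h _ := h.elim
  arm := by
    rintro _ _ _ _ ⟨⟩ ⟨⟩
    rfl
  mid := by simp

/-- By `armOf_injective` the arm vertex has a nontrivial position only in coordinate `i`, so nothing
is to be compared in the other coordinates. -/
theorem adj_arm_first (γ : Gadget G) {i : ℕ} (hi : i < γ.size) {j : ZMod g} {p : ℕ → ZMod g}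
    (h : (cycle g).Adj ((γ.sign i : ZMod g) * j) (p i)) (h0 : ∀ k, k ≠ i → p k = 0) :
    Adj o (.arm (γ.armOf o i) j) (.first γ p) where
  zone := ⟨γ, Or.inl ⟨⟨i, hi, rfl⟩, rfl⟩⟩
  near γ' k hk _ h' := by
    obtain rfl : γ = γ' := h'
    simp only [nearPos]
    split_ifs with e
    · obtain rfl := γ.armOf_injective o hk hi e
      exact h
    · rw [h0 k (fun hk => e (by rw [hk]))]
      exact (cycle g).refl 0
  far _ h _ := h.elim
  arm := by simp
  mid := by simp

end Label

end Prelim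

namespace Prelim

open ReflGraph

variable {V : Type*} {G : SimpleGraph V}

namespace Label

variable {g : ℕ} (o : EdgeOrder G) (α : V × Fin 3 → ℤ)

/-! ## A cocycle on labels -/

/-- The value on the `k`-th arm of a gadget. -/
def weight (γ : Gadget G) (k : ℕ) : ℤ := γ.sign k * α (γ.armOf o k)

/-- The value on `Z`. -/
def totalWeight (γ : Gadget G) : ℤ := ∑ k ∈ Finset.range γ.size, weight o α γ k

/-- The cocycle on a gadget without its last slice. -/
noncomputable def nearVal (γ : Gadget G) (X Y : Label G g) : ℤ :=
  ∑ k ∈ Finset.range γ.size, weight o α γ k * cycStep (nearPos o γ k X) (nearPos o γ k Y)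

/-- The potential by which the two descriptions of the cocycle differ. -/
def shift (γ : Gadget G) : Label G g → ℤ
  | mid _ x => ∑ k ∈ Finset.range γ.size, weight o α γ k * arcPotential γ.size g k x
  | _ => 0

/-- The cocycle on a gadget without its first slice. -/
def farVal (γ : Gadget G) (X Y : Label G g) : ℤ :=
  totalWeight o α γ * cycStep (farPos X) (farPos Y) + (shift o α γ Y - shift o α γ X)

open Classical in
/-- The cocycle on the first-stage graph with prescribed values on the `A^v_i`. -/
noncomputable def value (ζ : ℤ) (X Y : Label G g) : ℤ :=
  match owner X <|> owner Y with
  | some γ => if Near o γ X ∧ Near o γ Y then nearVal o α γ X Y else farVal o α γ X Y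
  | none => match X, Y with
    | star j, star j' => ζ * cycStep j j'
    | arm a j, arm _ j' => α a * cycStep j j'
    | _, _ => 0

variable {o} {α} {ζ : ℤ}

theorem near_eq_of_owner {γ γ' : Gadget G} {X : Label G g} (h : owner X = some γ')
    (hX : Near o γ X ∨ Far γ X) : γ' = γ := by
  cases X <;> simp_all [owner, Near, Far]

/-- Both descriptions apply only on the middle slices. There each arc map is homotopic to the
quotient map, and `shift` is the weighted sum of the homotopies. -/
theorem nearVal_eq_farVal (hg : 4 ≤ g) {X Y : Label G g} (h : Adj o X Y) {γ : Gadget G}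
    (hX : Near o γ X) (hY : Near o γ Y) (hX' : Far γ X) (hY' : Far γ Y) :
    nearVal o α γ X Y = farVal o α γ X Y := by
  cases X <;> first | exact hX.elim | exact hX'.elim | skip
  cases Y <;> first | exact hY.elim | exact hY'.elim | skip
  obtain rfl := hX
  obtain rfl := hY
  have hxx := h.mid _ _ _ _ rfl rfl
  simp only [nearVal, farVal, nearPos, farPos, shift, totalWeight]
  rw [Finset.sum_mul, ← Finset.sum_sub_distrib, ← Finset.sum_add_distrib]
  refine Finset.sum_congr rfl fun k hk => ?_
  rw [cycStep_arcMap hg (Finset.mem_range.1 hk) hxx]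
  ring

/-- The case without an owner is an edge of some $A^v_i$. The sign of the attachment then enters
twice, through the weight and through the position, and cancels; so all gadgets attached to $A^v_i$
give the same value. -/
theorem value_eq_nearVal (hg : 4 ≤ g) {X Y : Label G g} (h : Adj o X Y) {γ : Gadget G}
    (hX : Near o γ X) (hY : Near o γ Y) : value o α ζ X Y = nearVal o α γ X Y := by
  rcases e : (owner X <|> owner Y) with _ | γ'
  · cases X <;> simp [owner] at e <;> cases Y <;> simp at e
    · exact hX.elim
    · exact hX.elim
    · exact hY.elim
    · obtain rfl := h.arm _ _ _ _ rfl rfl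
      obtain ⟨k, hk, rfl⟩ := hX
      simp only [value, owner, nearVal, nearPos]
      rw [Finset.sum_eq_single k]
      · rw [if_pos rfl, if_pos rfl, cycStep_mul hg (γ.sign_eq k), weight]
        change α _ * cycStep _ _ = _
        rcases γ.sign_eq k with h1 | h1 <;> simp [h1]
      · intro k' hk' hne
        rw [if_neg fun e => hne (γ.armOf_injective o (Finset.mem_range.1 hk') hk e),
          if_neg fun e => hne (γ.armOf_injective o (Finset.mem_range.1 hk') hk e),
          cycStep_self hg, mul_zero]
      · exact fun h => (h (Finset.mem_range.2 hk)).elim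
  · have : γ' = γ := by
      rcases e1 : owner X with _ | γ₁
      · rw [e1] at e
        exact near_eq_of_owner (X := Y) (by simpa using e) (Or.inl hY)
      · rw [e1] at e
        exact near_eq_of_owner (X := X) (by simpa [e1] using e) (Or.inl hX)
    subst this
    simp only [value, e]
    rw [if_pos ⟨hX, hY⟩]

/-- The case without an owner is an edge of $Z^*$, shared by all the $S^v$; equality of their total
weights is what makes the value unambiguous. -/
theorem value_eq_farVal (hg : 4 ≤ g) (hζ : ∀ v, totalWeight o α (.atVertex v) = ζ)
    {X Y : Label G g} (h : Adj o X Y) {γ : Gadget G}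
    (hX : Far γ X) (hY : Far γ Y) : value o α ζ X Y = farVal o α γ X Y := by
  rcases e : (owner X <|> owner Y) with _ | γ'
  · cases X <;> simp [owner] at e <;> cases Y <;> simp at e
    · obtain ⟨v, rfl⟩ := hX
      simp only [value, owner, farVal, hζ, farPos, shift]
      simp
    · exact hY.elim
    · exact hX.elim
    · exact hX.elim
  · have : γ' = γ := by
      rcases e1 : owner X with _ | γ₁
      · rw [e1] at e
        exact near_eq_of_owner (o := o) (X := Y) (by simpa using e) (Or.inr hY)
      · rw [e1] at e
        exact near_eq_of_owner (o := o) (X := X) (by simpa [e1] using e) (Or.inr hX)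
    subst this
    simp only [value, e]
    split_ifs with h1
    · exact nearVal_eq_farVal hg h h1.1 h1.2 hX hY
    · rfl

/-- Three pairwise adjacent labels lie in a common zone. -/
theorem Adj.triple {X Y Z : Label G g} (h : Adj o X Y) (h' : Adj o Y Z) (h'' : Adj o X Z) :
    ∃ γ, (Near o γ X ∧ Near o γ Y ∧ Near o γ Z) ∨ (Far γ X ∧ Far γ Y ∧ Far γ Z) := by
  obtain ⟨γ₁, h1⟩ := h.zone
  obtain ⟨γ₂, h2⟩ := h'.zone
  obtain ⟨γ₃, h3⟩ := h''.zone
  have a1 := h.arm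
  have a2 := h'.arm
  have a3 := h''.arm
  clear h h' h''
  -- A label with an owner fixes the gadget. Otherwise all three lie on $Z^*$ or on one $A^v_i$, and
  -- any zone of the first pair works; the `arm` facts exclude vertices of two different $A^v_i$.
  cases X <;> cases Y <;> cases Z <;> simp only [Near, Far] at h1 h2 h3 ⊢ <;>
    first | grind | exact ⟨γ₁, by grind⟩

/-- In a common zone the value is a combination of pullbacks of `cycStep`, plus a coboundary in the
far case. -/
theorem value_add (hg : 4 ≤ g) (hζ : ∀ v, totalWeight o α (.atVertex v) = ζ) {X Y Z : Label G g}
    (h : Adj o X Y) (h' : Adj o Y Z) (h'' : Adj o X Z) :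
    value o α ζ X Y + value o α ζ Y Z = value o α ζ X Z := by
  obtain ⟨γ, ⟨hX, hY, hZ⟩ | ⟨hX, hY, hZ⟩⟩ := h.triple h' h''
  · rw [value_eq_nearVal hg h hX hY, value_eq_nearVal hg h' hY hZ, value_eq_nearVal hg h'' hX hZ]
    unfold nearVal
    rw [← Finset.sum_add_distrib]
    refine Finset.sum_congr rfl fun k hk => ?_
    have hk := Finset.mem_range.1 hk
    rw [← mul_add, isCocycle_cycStep hg (h.near γ k hk hX hY) (h'.near γ k hk hY hZ)
      (h''.near γ k hk hX hZ)]
  · rw [value_eq_farVal hg hζ h hX hY, value_eq_farVal hg hζ h' hY hZ,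
      value_eq_farVal hg hζ h'' hX hZ]
    unfold farVal
    rw [← isCocycle_cycStep hg (h.far γ hX hY) (h'.far γ hY hZ) (h''.far γ hX hZ)]
    ring

/-- The labels of the vertices of `T^*`. -/
def IsBase : Label G g → Prop
  | star j => j = 0
  | arm _ j => j = 0
  | first _ p => p = 0
  | mid _ x => x = 0
  | last _ j => j = 0

/-- All positions and shifts of such labels are $0$. Adjacency is not assumed, which gives the
vanishing on all pairs that `IsCocycle.extend_plug` asks for. -/
theorem value_eq_zero (hg : 4 ≤ g) {X Y : Label G g} (hX : IsBase X) (hY : IsBase Y) :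
    value o α ζ X Y = 0 := by
  have hnear : ∀ {X : Label G g} (γ k), IsBase X → nearPos o γ k X = 0 := by
    intro X γ k hX
    cases X <;> simp_all [IsBase, nearPos, arcMap]
    rintro rfl
    exact Nat.cast_zero
  have hfar : ∀ {X : Label G g}, IsBase X → farPos X = 0 := by
    intro X hX
    cases X <;> simp_all [IsBase, farPos]
  have hshift : ∀ {X : Label G g} (γ), IsBase X → shift o α γ X = 0 := by
    intro X γ hX
    cases X <;> simp_all [IsBase, shift, arcPotential]
  unfold value
  split
  · split_ifs
    · simp [nearVal, hnear _ _ hX, hnear _ _ hY, cycStep_self hg]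
    · simp [farVal, hfar hX, hfar hY, hshift _ hX, hshift _ hY, cycStep_self hg]
  · split
    · obtain rfl := hX
      obtain rfl := hY
      rw [cycStep_self hg, mul_zero]
    · obtain rfl := hX
      obtain rfl := hY
      rw [cycStep_self hg, mul_zero]
    · rfl

end Label

end Prelim

namespace Prelim

open ReflGraph

variable {V : Type*} {G : SimpleGraph V}

/-! ## The labelling of the first-stage graph -/

theorem Gadget.two_le_pathLen {l₂ l₃ : ℕ} (hl₂ : 2 ≤ l₂) (hl₃ : 2 ≤ l₃) (γ : Gadget G) :
    2 ≤ γ.pathLen l₂ l₃ := by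
  cases γ <;> assumption

/-- The labels of the vertices of the pieces from which a gadget is made. -/
def rawLabel (o : EdgeOrder G) (g l : ℕ) (γ : Gadget G) : SumGadget.Raw γ.size l g → Label G g
  | .inl (k, x) =>
    if k = Fin.last l then Label.ofLast γ ((x.val / γ.size : ℕ) : ZMod g)
    else if k = 0 then .first γ fun i => arcMap g i x.val
    else .mid γ x.val
  | .inr ⟨i, (b, j)⟩ =>
    if b = 0 then .first γ fun k => if i.val = k then j else 0
    else .arm (γ.armOf o i.val) ((γ.sign i.val : ZMod g) * j)

variable {o : EdgeOrder G} {g l : ℕ} {γ : Gadget G}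

/-- Labels keep just what the gluing preserves: `x / s` on the last slice, and on the first slice
the positions in the $A'_k$, which are all $0$ at the shared vertex. -/
theorem rawLabel_glue (hg : 4 ≤ g) (hl : 2 ≤ l) {r r' : SumGadget.Raw γ.size l g}
    (h : SumGadget.Glue γ.size l g r r') : rawLabel o g l γ r = rawLabel o g l γ r' := by
  have h0 : (0 : Fin (l + 1)) ≠ Fin.last l := fun h => by
    have := congrArg Fin.val h
    simp at this
    omega
  have hlast : ∀ (i : Fin γ.size) (j : Fin g),
      ((i.val + j.val * γ.size : ℕ) : ZMod (γ.size * g)).val / γ.size = j := by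
    intro i j
    have h1 : i.val + j.val * γ.size < γ.size * g := by
      have := Nat.mul_le_mul_right γ.size (Nat.succ_le_of_lt j.2)
      rw [Nat.succ_mul, mul_comm g] at this
      have := i.2
      omega
    rw [ZMod.val_cast_of_lt h1, Nat.add_mul_div_right _ _ γ.size_pos, Nat.div_eq_of_lt i.2, zero_add]
  have hbound : ∀ (i : Fin γ.size) (j : ℕ), j < g → i.val * g + j < γ.size * g := by
    intro i j hj
    have := Nat.mul_le_mul_right g (Nat.succ_le_of_lt i.2)
    rw [Nat.succ_mul] at this
    omega
  have hfirst : ∀ (i : Fin γ.size) (j : ℕ), j < g → ∀ k,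
      arcMap g k ((i.val * g + j : ℕ) : ZMod (γ.size * g)).val =
        if i.val = k then (j : ZMod g) else 0 := by
    intro i j hj k
    have h1 : (i.val * g + j) / g = i.val := by
      rw [add_comm, Nat.add_mul_div_right _ _ (by omega), Nat.div_eq_of_lt hj, zero_add]
    rw [ZMod.val_cast_of_lt (hbound i j hj), arcMap, h1]
    simp
  rcases h with ⟨i, i', j⟩ | ⟨i, i'⟩ | ⟨i, j⟩
  · simp only [rawLabel, if_true, hlast]
  · have h1 := hfirst i 0 (by omega)
    have h2 := hfirst i' 0 (by omega)
    simp only [add_zero, Nat.cast_zero, ite_self] at h1 h2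
    simp only [rawLabel, h0, if_true, if_false, h1, h2]
  · simp only [rawLabel, h0, if_true, if_false, hfirst i j j.2]

/-- A path of length at least $2$ keeps the first slice from being adjacent to the last one, so
every edge of a gadget lies in its near or in its far zone. -/
theorem rawLabel_adj (hg : 4 ≤ g) (hl : 2 ≤ l) {r r' : SumGadget.Raw γ.size l g}
    (h : (SumGadget.raw γ.size l g).Adj r r') :
    Label.Adj o (rawLabel o g l γ r) (rawLabel o g l γ r') := by
  have hg0 : 0 < g := by omega
  have : NeZero (γ.size * g) := ⟨(Nat.mul_pos γ.size_pos hg0).ne'⟩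
  rcases h with ⟨⟨k, x⟩, ⟨k', y⟩, rfl, rfl, hk, hxy⟩ |
    ⟨_, _, rfl, rfl, i, ⟨b, x⟩, ⟨b', y⟩, rfl, rfl, -, hxy⟩
  · have hxy := natAdj_val hxy
    obtain ⟨hk1, hk2⟩ := hk
    simp only at hk1 hk2
    simp only [rawLabel, Fin.ext_iff, Fin.val_last, Fin.val_zero]
    split_ifs
    · exact Label.adj_ofLast γ (div_adj γ.size_pos hxy)
    · omega
    · exact (Label.adj_mid_ofLast γ (div_adj γ.size_pos hxy.symm)).symm
    · omega
    · exact Label.adj_first γ fun i => arcMap_adj hg0 hxy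
    · exact Label.adj_first_mid γ fun i => arcMap_adj hg0 hxy
    · exact Label.adj_mid_ofLast γ (div_adj γ.size_pos hxy)
    · exact (Label.adj_first_mid γ fun i => arcMap_adj hg0 hxy.symm).symm
    · exact Label.adj_mid hg0 γ hxy
  · simp only at hxy
    have key : ∀ {x y : ZMod g}, (cycle g).Adj x y →
        Label.Adj o (.arm (γ.armOf o i.val) ((γ.sign i.val : ZMod g) * x) : Label G g)
          (.first γ fun k => if i.val = k then y else 0) := by
      intro x y hxy
      refine Label.adj_arm_first γ i.2 ?_ fun k hk => if_neg hk.symm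
      rw [if_pos rfl, ← mul_assoc, ← Int.cast_mul, γ.sign_mul_self, Int.cast_one, one_mul]
      exact hxy
    simp only [rawLabel]
    split_ifs
    · refine Label.adj_first γ fun k => ?_
      split_ifs
      · exact hxy
      · exact (cycle g).refl 0
    · exact (key ((cycle g).symm hxy)).symm
    · exact key hxy
    · exact Label.adj_arm _ (cycle_adj_mul (γ.sign_eq _) hxy)

variable {l₂ l₃ : ℕ}

/-- The vertices of the first-stage graph can be labelled. -/
theorem exists_label [Nonempty V] (o : EdgeOrder G) (hg : 4 ≤ g) (hl₂ : 2 ≤ l₂) (hl₃ : 2 ≤ l₃) :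
    ∃ L : Vertex o g l₂ l₃ → Label G g,
      (∀ x y, (graph o g l₂ l₃).Adj x y → Label.Adj o (L x) (L y)) ∧
      ∀ (γ : Gadget G) (r : SumGadget.Raw γ.size (γ.pathLen l₂ l₃) g),
        L ((incl o g l₂ l₃ γ).toFun (Quot.mk _ r)) = rawLabel o g (γ.pathLen l₂ l₃) γ r := by
  have hl := Gadget.two_le_pathLen (G := G) hl₂ hl₃
  let L₀ (γ : Gadget G) : SumGadget.Vertex γ.size (γ.pathLen l₂ l₃) g → Label G g :=
    Quot.lift (rawLabel o g (γ.pathLen l₂ l₃) γ) fun _ _ h => rawLabel_glue hg (hl γ) h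
  let L₁ : Raw G g l₂ l₃ → Label G g :=
    Sum.elim (fun p => .arm p.1 p.2) (Sum.elim .star fun p => L₀ p.1 p.2)
  have hL₁ : ∀ r r', Glue o g l₂ l₃ r r' → L₁ r = L₁ r' := by
    have harm : ∀ (γ : Gadget G) (i : Fin γ.size) (k : ZMod g),
        L₀ γ (SumGadget.armVertex i k) = .arm (γ.armOf o i.val) ((γ.sign i.val : ZMod g) * k) :=
      fun γ i k => by simp [L₀, SumGadget.armVertex, rawLabel]
    rintro _ _ (⟨v, j⟩ | ⟨v, i, k⟩ | ⟨v, i, j, h, k⟩ | ⟨v, i, j, h, k⟩ | ⟨e, i, k⟩ | ⟨e, i, k⟩)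
    · change L₀ (.atVertex v) (SumGadget.endVertex j) = .star j
      change (if Fin.last l₃ = Fin.last l₃ then Label.star
        ((((j * 3 : ℕ) : ZMod (3 * g)).val / 3 : ℕ) : ZMod g) else _) = _
      rw [if_pos rfl, ZMod.val_natCast, mul_comm j, Nat.mul_mod_mul_left,
        Nat.mul_div_cancel_left _ (by norm_num), ZMod.natCast_mod]
    · refine (harm (.atVertex v) i k).trans ?_
      simp [Gadget.armOf, Gadget.sign, L₁, rawArm]
    · refine (harm (.atPair v i j h) (0 : Fin 2) k).trans ?_
      simp [Gadget.armOf, Gadget.sign, L₁, rawArm]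
    · refine (harm (.atPair v i j h) (1 : Fin 2) k).trans ?_
      simp [Gadget.armOf, Gadget.sign, L₁, rawArm]
    · refine (harm (.atEdge e i) (0 : Fin 2) k).trans ?_
      simp [Gadget.armOf, Gadget.sign, L₁, rawArm]
    · refine (harm (.atEdge e i) (1 : Fin 2) k).trans ?_
      simp [Gadget.armOf, Gadget.sign, L₁, rawArm]
  refine ⟨Quot.lift L₁ hL₁, ?_, fun _ _ => rfl⟩
  rintro _ _ ⟨_, _, rfl, rfl, ⟨_, _, rfl, rfl, a, j, j', rfl, rfl, h⟩ |
    ⟨_, _, rfl, rfl, ⟨j, j', rfl, rfl, h⟩ | ⟨_, _, rfl, rfl, γ, _, _, rfl, rfl, r, r', rfl, rfl, h⟩⟩⟩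
  · exact Label.adj_arm a h
  -- An edge of $Z^*$ lies in the far zone of any $S^v$, and some vertex `v` exists.
  · exact Label.adj_ofLast (.atVertex (Classical.arbitrary V)) h
  · exact rawLabel_adj hg (hl γ) h

end Prelim

open ReflGraph

/-! ## The retraction of a gadget to its tree -/

namespace SumGadget

variable {s l g : ℕ}

/-- The retraction of a gadget to its tree. -/
def retract : Vertex s l g → Vertex s l g :=
  Quot.lift (fun
    | .inl (k, _) => body k 0
    | .inr ⟨i, (b, _)⟩ => if b = 0 then body 0 0 else armVertex i 0) <| by
  rintro _ _ (_ | _ | _) <;> rfl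

theorem retract_mem (x : Vertex s l g) : retract x ∈ treeVerts s l g := by
  rcases x with ⟨⟨k, x⟩ | ⟨i, ⟨b, x⟩⟩⟩
  · exact Or.inl ⟨k, rfl⟩
  · change (if b = 0 then body 0 0 else armVertex i 0) ∈ treeVerts s l g
    split_ifs
    · exact Or.inl ⟨0, rfl⟩
    · exact Or.inr ⟨i, rfl⟩

theorem retract_eq {x : Vertex s l g} (h : x ∈ treeVerts s l g) : retract x = x := by
  rcases h with ⟨k, rfl⟩ | ⟨i, rfl⟩ <;> rfl

theorem endVertex_zero : (endVertex 0 : Vertex s l g) = body (Fin.last l) 0 := by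
  simp [endVertex]

theorem arm_adj_body [NeZero g] (i : Fin s) :
    (graph s l g).Adj (armVertex i 0) (body 0 0) := by
  have h1 : (collarVertex i (0, 0) : Vertex s l g) = body 0 0 := by
    have h1 := collar_eq_body (l := l) (g := g) i (Nat.zero_le _)
    have h2 := body_first (l := l) (g := g) i ⟨0, i.pos⟩
    simp only [Nat.cast_zero, Nat.add_zero, Nat.zero_mul] at h1 h2
    rw [h1, h2]
  rw [← h1]
  exact (collarHom l i).map_adj (x := (1, 0)) (y := (0, 0))
    ⟨⟨by simp, by simp⟩, (cycle g).refl 0⟩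

theorem retract_adj [NeZero g] {x y : Vertex s l g} (h : (graph s l g).Adj x y) :
    (graph s l g).Adj (retract x) (retract y) := by
  obtain ⟨_, _, rfl, rfl, ⟨⟨k, x⟩, ⟨k', y⟩, rfl, rfl, h⟩ |
    ⟨_, _, rfl, rfl, i, ⟨b, x⟩, ⟨b', y⟩, rfl, rfl, h⟩⟩ := h
  · exact body_adj h.1 ((cycle _).refl 0)
  · change (graph s l g).Adj (if b = 0 then body 0 0 else armVertex i 0)
      (if b' = 0 then body 0 0 else armVertex i 0)
    split_ifs
    · exact (graph s l g).refl _
    · exact (graph s l g).symm (arm_adj_body i)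
    · exact arm_adj_body i
    · exact (graph s l g).refl _

/-- The distance of a slice to the arms. -/
def height : Vertex s l g → ℕ :=
  Quot.lift (fun
    | .inl (k, _) => k.val + 1
    | .inr ⟨_, (b, _)⟩ => if b = 0 then 1 else 0) <| by
  rintro _ _ (_ | _ | _) <;> rfl

theorem height_adj {x y : Vertex s l g} (h : (graph s l g).Adj x y) :
    height x ≤ height y + 1 := by
  obtain ⟨_, _, rfl, rfl, ⟨⟨k, x⟩, ⟨k', y⟩, rfl, rfl, h⟩ |
    ⟨_, _, rfl, rfl, i, ⟨b, x⟩, ⟨b', y⟩, rfl, rfl, h⟩⟩ := h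
  · exact Nat.succ_le_succ h.1.1
  · change (if b = 0 then 1 else 0) ≤ (if b' = 0 then 1 else 0) + 1
    split_ifs <;> omega

end SumGadget

/-! ## The tree union -/

namespace Prelim

variable {V : Type*} {G : SimpleGraph V} {o : EdgeOrder G} {g l₂ l₃ : ℕ}

open SumGadget Gadget

theorem incl_center (v : V) (j : ℕ) :
    (incl o g l₂ l₃ (atVertex v)).toFun (endVertex j) = Quot.mk _ (rawStar (j : ZMod g)) :=
  Quot.sound (Glue.center v j)

theorem incl_vertexArm (v : V) (i : Fin 3) (k : ZMod g) :
    (incl o g l₂ l₃ (atVertex v)).toFun (armVertex i k) = Quot.mk _ (rawArm v i k) :=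
  Quot.sound (Glue.vertexArm v i k)

theorem incl_pairFst (v : V) (i j : Fin 3) (h : i < j) (k : ZMod g) :
    (incl o g l₂ l₃ (atPair v i j h)).toFun (armVertex (s := 2) 0 k) =
      Quot.mk _ (rawArm v i k) :=
  Quot.sound (Glue.pairFst v i j h k)

theorem incl_pairSnd (v : V) (i j : Fin 3) (h : i < j) (k : ZMod g) :
    (incl o g l₂ l₃ (atPair v i j h)).toFun (armVertex (s := 2) 1 k) =
      Quot.mk _ (rawArm v j (-k)) :=
  Quot.sound (Glue.pairSnd v i j h k)

theorem incl_edgeFst (e : G.edgeSet) (i : Fin 3) (k : ZMod g) :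
    (incl o g l₂ l₃ (atEdge e i)).toFun (armVertex (s := 2) 0 k) =
      Quot.mk _ (rawArm (o.fst e) i k) :=
  Quot.sound (Glue.edgeFst e i k)

theorem incl_edgeSnd (e : G.edgeSet) (i : Fin 3) (k : ZMod g) :
    (incl o g l₂ l₃ (atEdge e i)).toFun (armVertex (s := 2) 1 k) =
      Quot.mk _ (rawArm (o.snd e) i k) :=
  Quot.sound (Glue.edgeSnd e i k)

theorem arm_mem_treeVerts (v : V) (i : Fin 3) :
    (Quot.mk _ (rawArm v i 0) : Vertex o g l₂ l₃) ∈ treeVerts o g l₂ l₃ :=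
  ⟨atVertex v, armVertex i 0, Or.inr ⟨i, rfl⟩, incl_vertexArm v i 0⟩

theorem star_mem_treeVerts [Nonempty V] :
    (Quot.mk _ (rawStar 0) : Vertex o g l₂ l₃) ∈ treeVerts o g l₂ l₃ := by
  refine ⟨atVertex (Classical.arbitrary V), endVertex 0, Or.inl ⟨_, endVertex_zero⟩, ?_⟩
  rw [incl_center, Nat.cast_zero]

/-- The first-stage graph retracts to `T^*`. -/
theorem exists_retraction [Nonempty V] [NeZero g] (o : EdgeOrder G) (l₂ l₃ : ℕ) :
    ∃ r : (graph o g l₂ l₃).Hom (treeUnion o g l₂ l₃), (∀ x, r.toFun x.1 = x) ∧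
      ∀ γ x, (r.toFun ((incl o g l₂ l₃ γ).toFun x)).1 = (incl o g l₂ l₃ γ).toFun (retract x) := by
  let r₀ : Raw G g l₂ l₃ → treeVerts o g l₂ l₃ := fun
    | .inl ⟨(v, i), _⟩ => ⟨_, arm_mem_treeVerts v i⟩
    | .inr (.inl _) => ⟨_, star_mem_treeVerts⟩
    | .inr (.inr ⟨γ, x⟩) => ⟨(incl o g l₂ l₃ γ).toFun (retract x), γ, _, retract_mem x, rfl⟩
  have hr₀ : ∀ a b, Glue o g l₂ l₃ a b → r₀ a = r₀ b := by
    rintro _ _ (⟨v, j⟩ | ⟨v, i, k⟩ | ⟨v, i, j, h, k⟩ | ⟨v, i, j, h, k⟩ | ⟨e, i, k⟩ | ⟨e, i, k⟩) <;>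
      apply Subtype.ext
    · refine (congrArg _ endVertex_zero.symm).trans ((incl_center v 0).trans ?_)
      rw [Nat.cast_zero]
      rfl
    · exact incl_vertexArm v i 0
    · exact incl_pairFst v i j h 0
    · refine (incl_pairSnd v i j h 0).trans ?_
      rw [neg_zero]
      rfl
    · exact incl_edgeFst e i 0
    · exact incl_edgeSnd e i 0
  refine ⟨⟨Quot.lift r₀ hr₀, ?_⟩, ?_, fun γ x => rfl⟩
  · rintro _ _ ⟨_, _, rfl, rfl, ⟨_, _, rfl, rfl, a, j, j', rfl, rfl, h⟩ |
      ⟨_, _, rfl, rfl, ⟨j, j', rfl, rfl, h⟩ | ⟨_, _, rfl, rfl, γ, x, y, rfl, rfl, h⟩⟩⟩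
    · exact (treeUnion o g l₂ l₃).refl _
    · exact (treeUnion o g l₂ l₃).refl _
    · exact ⟨γ, _, retract_mem x, _, retract_mem y, rfl, rfl, retract_adj h⟩
  · rintro ⟨_, γ, a, ha, rfl⟩
    exact Subtype.ext (congrArg (incl o g l₂ l₃ γ).toFun (retract_eq ha))

/-- The tree union is connected. -/
theorem treeUnion_connected [Nonempty V] [NeZero g] (x y : treeVerts o g l₂ l₃) :
    Relation.ReflTransGen (treeUnion o g l₂ l₃).Adj x y := by
  obtain ⟨r, hr, -⟩ := exists_retraction (g := g) o l₂ l₃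
  have hsymm : ∀ {x y}, Relation.ReflTransGen (treeUnion o g l₂ l₃).Adj x y →
      Relation.ReflTransGen (treeUnion o g l₂ l₃).Adj y x := fun {x y} h => by
    induction h with
    | refl => exact .refl
    | tail _ h ih => exact .head ((treeUnion o g l₂ l₃).symm h) ih
  let pt (γ : Gadget G) (a) : treeVerts o g l₂ l₃ := r.toFun ((incl o g l₂ l₃ γ).toFun a)
  have hpt : ∀ γ {a b}, (gadgetGraph G g l₂ l₃ γ).Adj a b →
      Relation.ReflTransGen (treeUnion o g l₂ l₃).Adj (pt γ a) (pt γ b) := fun γ _ _ h =>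
    .single (r.map_adj ((incl o g l₂ l₃ γ).map_adj h))
  have hbody : ∀ γ (k : Fin (γ.pathLen l₂ l₃ + 1)),
      Relation.ReflTransGen (treeUnion o g l₂ l₃).Adj (pt γ (body 0 0)) (pt γ (body k 0)) := by
    intro γ k
    induction k using Fin.induction with
    | zero => exact .refl
    | succ i ih => exact ih.trans (hpt γ (body_adj (path_adj_succ i) ((cycle _).refl 0)))
  have harm : ∀ γ (i : Fin γ.size),
      Relation.ReflTransGen (treeUnion o g l₂ l₃).Adj (pt γ (body 0 0)) (pt γ (armVertex i 0)) :=
    fun γ i => hsymm (hpt γ (arm_adj_body i))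
  let star : treeVerts o g l₂ l₃ := r.toFun (Quot.mk _ (rawStar 0))
  have hvertex : ∀ v, Relation.ReflTransGen (treeUnion o g l₂ l₃).Adj star
      (pt (atVertex v) (body 0 0)) := by
    intro v
    have h := hbody (atVertex v) (Fin.last _)
    have e : pt (atVertex v) (body (Fin.last _) 0) = star := by
      have h1 := incl_center (o := o) (g := g) (l₂ := l₂) (l₃ := l₃) v 0
      rw [Nat.cast_zero, endVertex_zero] at h1
      exact congrArg r.toFun h1
    rw [e] at h
    exact hsymm h
  -- A copy of $S_2$ is reached from $Z^*$ by crossing some $S^v$ and entering through its own arm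
  -- $0$.
  have hstar : ∀ γ, Relation.ReflTransGen (treeUnion o g l₂ l₃).Adj star (pt γ (body 0 0)) := by
    intro γ
    cases γ with
    | atVertex v => exact hvertex v
    | atPair v i j h =>
      have h1 := (hvertex v).trans (harm (atVertex v) i)
      have e : pt (atVertex v) (armVertex i 0) = pt (atPair v i j h) (armVertex (s := 2) 0 0) :=
        congrArg r.toFun ((incl_vertexArm v i 0).trans (incl_pairFst v i j h 0).symm)
      rw [e] at h1
      exact h1.trans (hsymm (harm (atPair v i j h) (0 : Fin 2)))
    | atEdge e i =>
      have h1 := (hvertex (o.fst e)).trans (harm (atVertex (o.fst e)) i)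
      have e' : pt (atVertex (o.fst e)) (armVertex i 0) =
          pt (atEdge e i) (armVertex (s := 2) 0 0) :=
        congrArg r.toFun ((incl_vertexArm _ i 0).trans (incl_edgeFst e i 0).symm)
      rw [e'] at h1
      exact h1.trans (hsymm (harm (atEdge e i) (0 : Fin 2)))
  have hall : ∀ x, Relation.ReflTransGen (treeUnion o g l₂ l₃).Adj star x := by
    intro x
    rw [← hr x]
    obtain ⟨_, γ, _, ⟨k, rfl⟩ | ⟨i, rfl⟩, rfl⟩ := x
    · exact (hstar γ).trans (hbody γ k)
    · exact (hstar γ).trans (harm γ i)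
  exact (hsymm (hall x)).trans (hall y)

/-- The tree union has no triangles. -/
theorem treeUnion_triangle [Nonempty V] (hg : 4 ≤ g) (hl₂ : 2 ≤ l₂) (hl₃ : 2 ≤ l₃)
    (x y z : treeVerts o g l₂ l₃) (hxy : (treeUnion o g l₂ l₃).Adj x y)
    (hyz : (treeUnion o g l₂ l₃).Adj y z) (hxz : (treeUnion o g l₂ l₃).Adj x z) :
    x = y ∨ y = z ∨ x = z := by
  obtain ⟨L, hL, hL'⟩ := exists_label o hg hl₂ hl₃
  let h₀ : Raw G g l₂ l₃ → ℕ := fun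
    | .inl _ => 0
    | .inr (.inl _) => l₃ + 1
    | .inr (.inr ⟨_, x⟩) => height x
  have hh₀ : ∀ a b, Glue o g l₂ l₃ a b → h₀ a = h₀ b := by
    rintro _ _ (_ | _ | _ | _ | _ | _) <;> rfl
  let h : Vertex o g l₂ l₃ → ℕ := Quot.lift h₀ hh₀
  have hadj : ∀ {x y : treeVerts o g l₂ l₃}, (treeUnion o g l₂ l₃).Adj x y →
      h x.1 ≤ h y.1 + 1 := by
    rintro ⟨x, hx⟩ ⟨y, hy⟩ ⟨γ, a, ha, b, hb, e, e', hab⟩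
    simp only at e e'
    subst e e'
    exact height_adj hab
  -- Within the tree of a gadget only arm vertices share a height. Adjacent ones lie on the same
  -- $A^v_i$ by their labels, hence are the same arm.
  have heq : ∀ {x y : treeVerts o g l₂ l₃}, (treeUnion o g l₂ l₃).Adj x y →
      h x.1 = h y.1 → x = y := by
    rintro ⟨x, hx⟩ ⟨y, hy⟩ ⟨γ, a, ha, b, hb, e, e', hab⟩ hxy
    simp only at e e'
    subst e e'
    have hxy : height a = height b := hxy
    apply Subtype.ext
    change (incl o g l₂ l₃ γ).toFun a = (incl o g l₂ l₃ γ).toFun b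
    rcases ha with ⟨k, rfl⟩ | ⟨i, rfl⟩ <;> rcases hb with ⟨k', rfl⟩ | ⟨i', rfl⟩
    · rw [Fin.ext (Nat.succ.inj hxy)]
    · exact absurd hxy (Nat.succ_ne_zero _)
    · exact absurd hxy.symm (Nat.succ_ne_zero _)
    · have harm : ∀ i : Fin γ.size, L ((incl o g l₂ l₃ γ).toFun (armVertex i 0)) =
          .arm (γ.armOf o i.val) ((γ.sign i.val : ZMod g) * 0) := fun i =>
        (hL' γ (Sum.inr ⟨i, (1, 0)⟩)).trans (by simp [rawLabel])
      have h1 := (hL _ _ ((incl o g l₂ l₃ γ).map_adj hab)).arm _ _ _ _ (harm i) (harm i')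
      rw [Fin.ext (γ.armOf_injective o i.2 i'.2 h1)]
  have h1 := hadj hxy
  have h2 := hadj ((treeUnion o g l₂ l₃).symm hxy)
  have h3 := hadj hyz
  have h4 := hadj ((treeUnion o g l₂ l₃).symm hyz)
  have h5 := hadj hxz
  have h6 := hadj ((treeUnion o g l₂ l₃).symm hxz)
  by_cases e1 : h x.1 = h y.1
  · exact Or.inl (heq hxy e1)
  by_cases e2 : h y.1 = h z.1
  · exact Or.inr (Or.inl (heq hyz e2))
  -- Three integers pairwise at distance at most $1$ cannot all be different.
  · exact Or.inr (Or.inr (heq hxz (by omega)))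

end Prelim

open ReflGraph

/-! ### Steps along the arms and the end cycle -/

namespace SumGadget

variable {s l g : ℕ}

theorem arm_adj (i : Fin s) {x y : ZMod g} (h : (cycle g).Adj x y) :
    (graph s l g).Adj (armVertex i x) (armVertex i y) :=
  (collarHom l i).map_adj (x := (1, x)) (y := (1, y)) ⟨(path 1).refl 1, h⟩

theorem endVertex_mod (j : ℕ) : (endVertex (j % g) : Vertex s l g) = endVertex j := by
  unfold endVertex
  congr 1
  rw [ZMod.natCast_eq_natCast_iff', mul_comm, mul_comm j, Nat.mul_mod_mul_left, Nat.mod_mod,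
    Nat.mul_mod_mul_left]

theorem endVertex_adj_succ [NeZero g] (j : ℕ) :
    (graph s l g).Adj (endVertex j) (endVertex (j + 1)) := by
  have h := endVertex_adj (s := s) (l := l) (⟨j % g, Nat.mod_lt _ (NeZero.pos g)⟩ : Fin g)
  have e : (endVertex (j % g + 1) : Vertex s l g) = endVertex (j + 1) := by
    rw [← endVertex_mod (j % g + 1), Nat.mod_add_mod, endVertex_mod]
  simp only [endVertex_mod, e] at h
  exact h

theorem arm_sum_eq_zero {Q : Type*} [AddCommGroup Q] {f : Vertex s l g → Vertex s l g → Q}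
    {i : Fin s} {p : ZMod g → Q}
    (h : ∀ x, f (armVertex i x) (armVertex i (x + 1)) = p (x + 1) - p x) : (arm i).sum f = 0 := by
  have h1 : (arm i).sum f =
      ∑ t ∈ Finset.range g, (p ((t + 1 : ℕ) : ZMod g) - p (t : ZMod g)) := by
    rw [← Fin.sum_univ_eq_sum_range fun t => p ((t + 1 : ℕ) : ZMod g) - p (t : ZMod g)]
    refine Finset.sum_congr rfl fun j _ => ?_
    rw [Nat.cast_succ, ← h, ← Nat.cast_succ]
    rfl
  rw [h1, Finset.sum_range_sub fun t : ℕ => p (t : ZMod g)]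
  simp

end SumGadget

namespace Prelim

variable {V : Type*} {G : SimpleGraph V} {o : EdgeOrder G} {g l₂ l₃ : ℕ}

open SumGadget Gadget

/-- Each arm of a gadget is attached to some `A^v_i`. -/
theorem exists_attach (o : EdgeOrder G) (g l₂ l₃ : ℕ) (γ : Gadget G) (k : Fin γ.size) :
    ∃ (v : V) (i : Fin 3) (σ : ℤ), (σ = 1 ∨ σ = -1) ∧ ∀ x : ZMod g,
      (incl o g l₂ l₃ γ).toFun (armVertex k x) = Quot.mk _ (rawArm v i ((σ : ZMod g) * x)) := by
  cases γ with
  | atVertex v => exact ⟨v, k, 1, Or.inl rfl, fun x =>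
      (incl_vertexArm v k x).trans (by simp)⟩
  | atPair v i j h =>
    obtain rfl | rfl : k = (0 : Fin 2) ∨ k = (1 : Fin 2) := by
      have : ∀ k : Fin 2, k = 0 ∨ k = 1 := by decide
      exact this k
    · exact ⟨v, i, 1, Or.inl rfl, fun x =>
      (incl_pairFst v i j h x).trans (by simp)⟩
    · exact ⟨v, j, -1, Or.inr rfl, fun x =>
      (incl_pairSnd v i j h x).trans (by simp)⟩
  | atEdge e i =>
    obtain rfl | rfl : k = (0 : Fin 2) ∨ k = (1 : Fin 2) := by
      have : ∀ k : Fin 2, k = 0 ∨ k = 1 := by decide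
      exact this k
    · exact ⟨o.fst e, i, 1, Or.inl rfl, fun x =>
      (incl_edgeFst e i x).trans (by simp)⟩
    · exact ⟨o.snd e, i, 1, Or.inl rfl, fun x =>
      (incl_edgeSnd e i x).trans (by simp)⟩

/-- The gadget `S^v` in the first-stage graph. -/
def inclVertex (o : EdgeOrder G) (g l₂ l₃ : ℕ) (v : V) :
    (SumGadget.graph 3 l₃ g).Hom (graph o g l₂ l₃) := incl o g l₂ l₃ (atVertex v)

/-! ## A family of end gadget-cycles -/

/-- The cycles `Z^*`, `A^v_0` and `A^v_1`. -/
noncomputable def basisCycle [Nonempty V] (o : EdgeOrder G) (g l₂ l₃ : ℕ) :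
    Option (V × Fin 2) → (graph o g l₂ l₃).ClosedWalk
  | none => endCycle.map (inclVertex o g l₂ l₃ (Classical.arbitrary V))
  | some (v, i) => (arm i.castSucc).map (inclVertex o g l₂ l₃ v)

/-! ### Gluing potentials over the first-stage graph -/

section Spanning

variable {Q : Type*} [AddCommGroup Q] {f : Vertex o g l₂ l₃ → Vertex o g l₂ l₃ → Q}

theorem inclVertex_center (v : V) (j : ℕ) :
    (inclVertex o g l₂ l₃ v).toFun (endVertex j) = Quot.mk _ (rawStar (j : ZMod g)) :=
  incl_center v j

theorem inclVertex_arm (v : V) (i : Fin 3) (k : ZMod g) :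
    (inclVertex o g l₂ l₃ v).toFun (armVertex i k) = Quot.mk _ (rawArm v i k) :=
  incl_vertexArm v i k

/-- In $S^v$ the relation $[Z^*]=[A_0]+[A_1]+[A_2]$ forces the cocycle to vanish on the omitted
cycle $A^v_2$ too. The cycle $Z^*$ is the same walk seen from every `v`. -/
theorem exists_potential_vertex [Nonempty V] [NeZero g] (hf : (graph o g l₂ l₃).IsCocycle f)
    (h0 : ∀ i, (basisCycle o g l₂ l₃ i).sum f = 0) (v : V) :
    ∃ h : SumGadget.Vertex 3 l₃ g → Q, ∀ x y, (SumGadget.graph 3 l₃ g).Adj x y →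
      f ((inclVertex o g l₂ l₃ v).toFun x) ((inclVertex o g l₂ l₃ v).toFun y) = h y - h x := by
  have hfv := hf.comp (inclVertex o g l₂ l₃ v)
  refine SumGadget.exists_potential hfv ?_
  have hstar : (endCycle.sum fun x y =>
      f ((inclVertex o g l₂ l₃ v).toFun x) ((inclVertex o g l₂ l₃ v).toFun y)) = 0 := by
    rw [← h0 none]
    refine Finset.sum_congr rfl fun j _ => ?_
    exact congrArg₂ f ((inclVertex_center v j.val).trans (inclVertex_center _ j.val).symm)
      ((inclVertex_center v (j.val + 1)).trans (inclVertex_center _ (j.val + 1)).symm)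
  have hlt : ∀ i : Fin 2, ((arm i.castSucc).sum fun x y =>
      f ((inclVertex o g l₂ l₃ v).toFun x) ((inclVertex o g l₂ l₃ v).toFun y)) = 0 := fun i =>
    h0 (some (v, i))
  have h1 := endCycle_sum_eq hfv
  rw [hstar, Fin.sum_univ_castSucc, Finset.sum_eq_zero fun i _ => hlt i, zero_add] at h1
  exact fun i => Fin.lastCases h1.symm hlt i

/-- Each arm of a gadget is some $A^v_i$, possibly reversed, and there the potential of $S^v$ is
available; so the cocycle vanishes on all arms. -/
theorem exists_potential_gadget [Nonempty V] [NeZero g] (hf : (graph o g l₂ l₃).IsCocycle f)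
    (h0 : ∀ i, (basisCycle o g l₂ l₃ i).sum f = 0) (γ : Gadget G) :
    ∃ h : SumGadget.Vertex γ.size (γ.pathLen l₂ l₃) g → Q, ∀ x y,
      (gadgetGraph G g l₂ l₃ γ).Adj x y →
        f ((incl o g l₂ l₃ γ).toFun x) ((incl o g l₂ l₃ γ).toFun y) = h y - h x := by
  have : NeZero γ.size := ⟨γ.size_pos.ne'⟩
  refine SumGadget.exists_potential (hf.comp (incl o g l₂ l₃ γ)) fun k => ?_
  obtain ⟨v, i, σ, hσ, hx⟩ := exists_attach o g l₂ l₃ γ k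
  obtain ⟨h, hh⟩ := exists_potential_vertex hf h0 v
  refine arm_sum_eq_zero (p := fun x => h (armVertex i ((σ : ZMod g) * x))) fun x => ?_
  rw [← hh _ _ (arm_adj i (cycle_adj_mul hσ (cycle_adj_succ x))), inclVertex_arm, inclVertex_arm,
    hx, hx]

/-- A cocycle on the first-stage graph that vanishes on the cycles `Z^*`, `A^v_0`, `A^v_1` is a
coboundary if its restriction to the tree union is one. -/
theorem exists_potential_graph [Nonempty V] [NeZero g] (hf : (graph o g l₂ l₃).IsCocycle f)
    (h0 : ∀ i, (basisCycle o g l₂ l₃ i).sum f = 0)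
    (hT : ∃ h : treeVerts o g l₂ l₃ → Q, ∀ x y, (treeUnion o g l₂ l₃).Adj x y →
      f x.1 y.1 = h y - h x) :
    ∃ h : Vertex o g l₂ l₃ → Q, ∀ x y, (graph o g l₂ l₃).Adj x y → f x y = h y - h x := by
  obtain ⟨hT, hhT⟩ := hT
  choose h' hh' using exists_potential_gadget hf h0
  let tr (γ : Gadget G) (a : SumGadget.Vertex γ.size (γ.pathLen l₂ l₃) g) : treeVerts o g l₂ l₃ :=
    ⟨(incl o g l₂ l₃ γ).toFun (retract a), γ, _, retract_mem a, rfl⟩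
  -- The additive constant is chosen to match the potential of $T^*$ at one vertex of the gadget's
  -- tree; the match then spreads along the whole tree.
  let h (γ : Gadget G) (a : SumGadget.Vertex γ.size (γ.pathLen l₂ l₃) g) : Q :=
    h' γ a - h' γ (body 0 0) + hT (tr γ (body 0 0))
  have hh : ∀ γ a b, (gadgetGraph G g l₂ l₃ γ).Adj a b →
      f ((incl o g l₂ l₃ γ).toFun a) ((incl o g l₂ l₃ γ).toFun b) = h γ b - h γ a := by
    intro γ a b hab
    rw [hh' γ a b hab]
    simp only [h]
    abel
  have htr0 : ∀ γ, h γ (body 0 0) = hT (tr γ (body 0 0)) := fun γ => by simp [h]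
  have htr : ∀ γ {a b : SumGadget.Vertex γ.size (γ.pathLen l₂ l₃) g}, retract a = a →
      retract b = b → (gadgetGraph G g l₂ l₃ γ).Adj a b → h γ a = hT (tr γ a) →
      h γ b = hT (tr γ b) := by
    intro γ a b ha hb hab e
    have h1 := hhT (tr γ a) (tr γ b) ⟨γ, _, retract_mem a, _, retract_mem b, rfl, rfl, by
      rw [ha, hb]
      exact hab⟩
    have h2 := hh γ a b hab
    simp only [tr, ha, hb] at h1 e ⊢
    rw [h2, e] at h1
    exact sub_left_injective h1
  have hbody : ∀ γ (k : Fin (γ.pathLen l₂ l₃ + 1)), h γ (body k 0) = hT (tr γ (body k 0)) := by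
    intro γ k
    induction k using Fin.induction with
    | zero => exact htr0 γ
    | succ i ih => exact htr γ rfl rfl (body_adj (path_adj_succ i) ((cycle _).refl 0)) ih
  have harm : ∀ γ (k : Fin γ.size), h γ (armVertex k 0) = hT (tr γ (armVertex k 0)) := fun γ k =>
    htr γ rfl rfl ((gadgetGraph G g l₂ l₃ γ).symm (arm_adj_body k)) (htr0 γ)
  let hv (v : V) : SumGadget.Vertex 3 l₃ g → Q := h (atVertex v)
  have hhv : ∀ v a b, (SumGadget.graph 3 l₃ g).Adj a b →
      f ((inclVertex o g l₂ l₃ v).toFun a) ((inclVertex o g l₂ l₃ v).toFun b) =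
        hv v b - hv v a := fun v => hh (atVertex v)
  -- The two potentials on a glued cycle have the same increments and agree at the vertex $0$, which
  -- lies in $T^*$ and is fixed by the reversal.
  have hattach : ∀ (γ : Gadget G) (k : Fin γ.size) (v : V) (i : Fin 3) (σ : ℤ),
      (σ = 1 ∨ σ = -1) → (∀ x : ZMod g,
        (incl o g l₂ l₃ γ).toFun (armVertex k x) = Quot.mk _ (rawArm v i ((σ : ZMod g) * x))) →
      ∀ x, h γ (armVertex k x) = hv v (armVertex i ((σ : ZMod g) * x)) := by
    intro γ k v i σ hσ hx x
    rw [← ZMod.natCast_zmod_val x]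
    induction x.val with
    | zero =>
      rw [Nat.cast_zero, mul_zero, harm]
      refine Eq.trans ?_ (harm (atVertex v) i).symm
      refine congrArg hT (Subtype.ext ?_)
      have h1 := hx 0
      rw [mul_zero] at h1
      exact h1.trans (inclVertex_arm v i 0).symm
    | succ n ih =>
      have h1 := hh γ _ _ (arm_adj k (cycle_adj_succ (n : ZMod g)))
      have h2 := hhv v _ _ (arm_adj i (cycle_adj_mul hσ (cycle_adj_succ (n : ZMod g))))
      rw [inclVertex_arm, inclVertex_arm, ← hx, ← hx, h1, ih] at h2
      rw [Nat.cast_succ]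
      exact sub_left_injective h2
  have hcenter : ∀ (v v' : V) (j : ℕ), hv v (endVertex j) = hv v' (endVertex j) := by
    intro v v' j
    induction j with
    | zero =>
      rw [endVertex_zero]
      refine (hbody (atVertex v) (Fin.last l₃)).trans
        (Eq.trans ?_ (hbody (atVertex v') (Fin.last l₃)).symm)
      refine congrArg hT (Subtype.ext ?_)
      have h1 := (inclVertex_center (o := o) (g := g) (l₂ := l₂) (l₃ := l₃) v 0).trans
        (inclVertex_center v' 0).symm
      rw [endVertex_zero] at h1
      exact h1
    | succ n ih =>
      have h1 := hhv v _ _ (endVertex_adj_succ n)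
      have h2 := hhv v' _ _ (endVertex_adj_succ n)
      rw [inclVertex_center, inclVertex_center] at h1 h2
      rw [h1, ih] at h2
      exact sub_left_injective h2
  let v₀ : V := Classical.arbitrary V
  let H₀ : Raw G g l₂ l₃ → Q := fun
    | .inl ⟨(v, i), j⟩ => hv v (armVertex i j)
    | .inr (.inl j) => hv v₀ (endVertex j.val)
    | .inr (.inr ⟨γ, x⟩) => h γ x
  have hH₀ : ∀ a b, Glue o g l₂ l₃ a b → H₀ a = H₀ b := by
    rintro _ _ (⟨v, j⟩ | ⟨v, i, k⟩ | ⟨v, i, j, h, k⟩ | ⟨v, i, j, h, k⟩ | ⟨e, i, k⟩ | ⟨e, i, k⟩)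
    · refine (hcenter v v₀ j).trans ?_
      change _ = hv v₀ (endVertex (j : ZMod g).val)
      rw [ZMod.val_natCast, endVertex_mod]
    · rfl
    · refine (hattach _ _ v i 1 (Or.inl rfl) (fun x => (incl_pairFst v i j h x).trans ?_) k).trans ?_
      · simp
      · simp [H₀, rawArm]
    · refine (hattach _ _ v j (-1) (Or.inr rfl) (fun x => (incl_pairSnd v i j h x).trans ?_) k).trans
        ?_
      · simp
      · simp [H₀, rawArm]
    · refine (hattach _ _ (o.fst e) i 1 (Or.inl rfl) (fun x => (incl_edgeFst e i x).trans ?_) k).trans ?_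
      · simp
      · simp [H₀, rawArm]
    · refine (hattach _ _ (o.snd e) i 1 (Or.inl rfl) (fun x => (incl_edgeSnd e i x).trans ?_) k).trans ?_
      · simp
      · simp [H₀, rawArm]
  refine ⟨Quot.lift H₀ hH₀, ?_⟩
  rintro _ _ ⟨_, _, rfl, rfl, ⟨_, _, rfl, rfl, ⟨v, i⟩, j, j', rfl, rfl, hj⟩ |
    ⟨_, _, rfl, rfl, ⟨j, j', rfl, rfl, hj⟩ | ⟨_, _, rfl, rfl, γ, x, y, rfl, rfl, hxy⟩⟩⟩
  · have h1 := hhv v _ _ (arm_adj i hj)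
    rw [inclVertex_arm, inclVertex_arm] at h1
    exact h1
  · have key : ∀ j : ZMod g, f (Quot.mk _ (rawStar j)) (Quot.mk _ (rawStar (j + 1))) =
        hv v₀ (endVertex (j + 1).val) - hv v₀ (endVertex j.val) := by
      intro j
      have h1 := hhv v₀ _ _ (endVertex_adj_succ j.val)
      rw [inclVertex_center, inclVertex_center, Nat.cast_succ, ZMod.natCast_zmod_val] at h1
      rw [h1, ← endVertex_mod (j.val + 1)]
      congr 3
      rw [← ZMod.val_natCast, Nat.cast_succ, ZMod.natCast_zmod_val]
    rcases hj with rfl | rfl | rfl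
    · rw [sub_self]
      exact hf.self _
    · exact key j
    · have h1 : (graph o g l₂ l₃).Adj (Quot.mk _ (rawStar j')) (Quot.mk _ (rawStar (j' + 1))) :=
        ⟨_, _, rfl, rfl, Or.inr ⟨_, _, rfl, rfl, Or.inl ⟨_, _, rfl, rfl, cycle_adj_succ j'⟩⟩⟩
      exact (hf.neg_symm h1).trans ((congrArg Neg.neg (key j')).trans (neg_sub _ _))
  · exact hh γ x y hxy

end Spanning

end Prelim

open ReflGraph

namespace Prelim

universe u

variable {V : Type u} {G : SimpleGraph V} {o : EdgeOrder G} {g l₂ l₃ : ℕ}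

open SumGadget Gadget

/-! ## Independence -/

theorem ofNat_three (i : Fin 3) : Fin.ofNat 3 i.val = i := Fin.ext (by simp)

/-- The labels of the vertices of `Z^*` and of the `A^v_i`. -/
theorem exists_label_vertex [Nonempty V] (o : EdgeOrder G) (hg : 4 ≤ g) (hl₂ : 2 ≤ l₂)
    (hl₃ : 2 ≤ l₃) : ∃ L : Vertex o g l₂ l₃ → Label G g,
      (∀ x y, (graph o g l₂ l₃).Adj x y → Label.Adj o (L x) (L y)) ∧
      (∀ (γ : Gadget G) (r : SumGadget.Raw γ.size (γ.pathLen l₂ l₃) g),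
        L ((incl o g l₂ l₃ γ).toFun (Quot.mk _ r)) = rawLabel o g (γ.pathLen l₂ l₃) γ r) ∧
      (∀ v j, L ((inclVertex o g l₂ l₃ v).toFun (endVertex j)) = .star (j : ZMod g)) ∧
      ∀ v (i : Fin 3) (j : ZMod g),
        L ((inclVertex o g l₂ l₃ v).toFun (armVertex i j)) = .arm (v, i) j := by
  obtain ⟨L, hL, hL'⟩ := exists_label o hg hl₂ hl₃
  have hlast : ∀ v j, L ((inclVertex o g l₂ l₃ v).toFun (endVertex j)) = .star (j : ZMod g) := by
    intro v j
    refine (hL' (atVertex v) (.inl (Fin.last l₃, ((j * 3 : ℕ) : ZMod (3 * g))))).trans ?_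
    change (if Fin.last l₃ = Fin.last l₃ then Label.star
        ((((j * 3 : ℕ) : ZMod (3 * g)).val / 3 : ℕ) : ZMod g) else _) = _
    rw [if_pos rfl, ZMod.val_natCast, mul_comm j, Nat.mul_mod_mul_left,
      Nat.mul_div_cancel_left _ (by norm_num), ZMod.natCast_mod]
  have harm : ∀ v (i : Fin 3) (j : ZMod g),
      L ((inclVertex o g l₂ l₃ v).toFun (armVertex i j)) = .arm (v, i) j := by
    intro v i j
    refine (hL' (atVertex v) (.inr ⟨i, (1, j)⟩)).trans ?_
    simp [rawLabel, armOf, sign]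
  exact ⟨L, hL, hL', hlast, harm⟩

/-- Integer cocycles on the first-stage graph with prescribed values on the `A^v_i` and on `Z^*`,
vanishing on `T^*`. -/
theorem exists_cocycle [Nonempty V] (o : EdgeOrder G) (hg : 4 ≤ g) (hl₂ : 2 ≤ l₂) (hl₃ : 2 ≤ l₃)
    (α : V × Fin 3 → ℤ) (ζ : ℤ) (hζ : ∀ v, ∑ i, α (v, i) = ζ) :
    ∃ f : Vertex o g l₂ l₃ → Vertex o g l₂ l₃ → ℤ, (graph o g l₂ l₃).IsCocycle f ∧
      (∀ x ∈ treeVerts o g l₂ l₃, ∀ y ∈ treeVerts o g l₂ l₃, f x y = 0) ∧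
      (basisCycle o g l₂ l₃ none).sum f = g * ζ ∧
      ∀ v i, (basisCycle o g l₂ l₃ (some (v, i))).sum f = g * α (v, i.castSucc) := by
  obtain ⟨L, hL, hL', hlast, harm⟩ := exists_label_vertex o hg hl₂ hl₃
  have htot : ∀ v, Label.totalWeight o α (.atVertex v) = ζ := by
    intro v
    rw [← hζ v]
    change ∑ k ∈ Finset.range 3, 1 * α (v, Fin.ofNat 3 k) = _
    rw [← Fin.sum_univ_eq_sum_range fun k => 1 * α (v, Fin.ofNat 3 k)]
    refine Finset.sum_congr rfl fun i _ => ?_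
    rw [one_mul, ofNat_three]
  refine ⟨fun x y => Label.value o α ζ (L x) (L y), fun x y z h h' h'' =>
    Label.value_add hg htot (hL _ _ h) (hL _ _ h') (hL _ _ h''), ?_, ?_, ?_⟩
  · have hbase : ∀ x ∈ treeVerts o g l₂ l₃, Label.IsBase (L x) := by
      rintro _ ⟨γ, _, ⟨k, rfl⟩ | ⟨i, rfl⟩, rfl⟩
      · refine (congrArg Label.IsBase (hL' γ (.inl (k, 0)))).mpr ?_
        simp only [rawLabel, ZMod.val_zero, Nat.zero_div, Nat.cast_zero]
        split_ifs
        · cases γ <;> exact rfl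
        · funext i
          simp [arcMap]
        · exact rfl
      · refine (congrArg Label.IsBase (hL' γ (.inr ⟨i, (1, 0)⟩))).mpr ?_
        simp [rawLabel, Label.IsBase]
    exact fun x hx y hy => Label.value_eq_zero hg (hbase x hx) (hbase y hy)
  · change ∑ j : Fin g, Label.value o α ζ (L ((inclVertex o g l₂ l₃ _).toFun (endVertex j.val)))
      (L ((inclVertex o g l₂ l₃ _).toFun (endVertex (j.val + 1)))) = _
    simp only [hlast, Nat.cast_succ]
    simp [Label.value, Label.owner, cycStep_succ]
  · intro v i
    change ∑ j : Fin g, Label.value o α ζ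
      (L ((inclVertex o g l₂ l₃ v).toFun (armVertex i.castSucc (j.val : ZMod g))))
      (L ((inclVertex o g l₂ l₃ v).toFun (armVertex i.castSucc ((j.val + 1 : ℕ) : ZMod g)))) = _
    simp only [harm, Nat.cast_succ]
    simp [Label.value, Label.owner, cycStep_succ]

/-- Cocycles that separate the cycles `Z^*`, `A^v_0` and `A^v_1`. -/
theorem exists_separating_cocycle [Nonempty V] (o : EdgeOrder G) (hg : 4 ≤ g) (hl₂ : 2 ≤ l₂)
    (hl₃ : 2 ≤ l₃) (a : Option (V × Fin 2)) :
    ∃ f : Vertex o g l₂ l₃ → Vertex o g l₂ l₃ → ℤ, (graph o g l₂ l₃).IsCocycle f ∧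
      (∀ x ∈ treeVerts o g l₂ l₃, ∀ y ∈ treeVerts o g l₂ l₃, f x y = 0) ∧
      (basisCycle o g l₂ l₃ a).sum f ≠ 0 ∧
      ∀ b, b ≠ a → (basisCycle o g l₂ l₃ b).sum f = 0 := by
  classical
  have hg0 : (g : ℤ) ≠ 0 := by
    have : g ≠ 0 := by omega
    exact_mod_cast this
  have hne : ∀ i : Fin 2, i.castSucc ≠ Fin.last 2 := fun i => (Fin.castSucc_lt_last i).ne
  rcases a with _ | ⟨w, i₀⟩
  -- To isolate $Z^*$, all weight is put on the cycles $A^v_2$, which are not in the family.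
  · obtain ⟨f, hf, hT, h1, h2⟩ := exists_cocycle (l₂ := l₂) (l₃ := l₃) o hg hl₂ hl₃
      (fun a => if a.2 = Fin.last 2 then 1 else 0) 1 fun v => by simp
    refine ⟨f, hf, hT, by rw [h1, mul_one]; exact hg0, ?_⟩
    rintro (_ | ⟨v, i⟩) h
    · exact (h rfl).elim
    · rw [h2, if_neg (hne i), mul_zero]
  -- To isolate $A^w_{i_0}$, the opposite weight on $A^w_2$ keeps the value on $Z^*$ at zero.
  · obtain ⟨f, hf, hT, h1, h2⟩ := exists_cocycle (l₂ := l₂) (l₃ := l₃) o hg hl₂ hl₃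
      (fun a => if a.1 = w then
        (if a.2 = i₀.castSucc then 1 else 0) - (if a.2 = Fin.last 2 then 1 else 0) else 0) 0
      fun v => by
        by_cases h : v = w <;> simp [h]
    refine ⟨f, hf, hT, ?_, ?_⟩
    · rw [h2, if_pos rfl, if_pos rfl, if_neg (hne i₀), sub_zero, mul_one]
      exact hg0
    · rintro (_ | ⟨v, i⟩) h
      · rw [h1, mul_zero]
      · rw [h2]
        by_cases hv : v = w
        · subst hv
          have hi : i.castSucc ≠ i₀.castSucc := fun e => h (by rw [Fin.castSucc_injective _ e])
          rw [if_pos rfl, if_neg hi, if_neg (hne i), sub_zero, mul_zero]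
        · rw [if_neg hv, mul_zero]

theorem basisCycle_mem_endGadgetCycles [Nonempty V] (a : Option (V × Fin 2)) :
    basisCycle o g l₂ l₃ a ∈ endGadgetCycles o g l₂ l₃ := by
  rcases a with _ | ⟨v, i⟩
  · exact ⟨atVertex (Classical.arbitrary V), endCycle, Or.inl rfl, rfl⟩
  · exact ⟨atVertex v, arm (s := 3) i.castSucc, Or.inr ⟨_, rfl⟩, rfl⟩

theorem natCast_fin_injective : Function.Injective fun j : Fin g => ((j.val : ℕ) : ZMod g) := by
  intro i j h
  have h' := congrArg ZMod.val h
  simp only [ZMod.val_cast_of_lt i.2, ZMod.val_cast_of_lt j.2] at h'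
  exact Fin.ext h'

/-- That no vertex repeats is read off from the labels, which record the position on $Z^*$ and on
$A^v_i$. -/
theorem basisCycle_mem_gadgetCycles [Nonempty V] (hg : 4 ≤ g) (hl₂ : 2 ≤ l₂) (hl₃ : 2 ≤ l₃)
    (a : Option (V × Fin 2)) : basisCycle o g l₂ l₃ a ∈ gadgetCycles o g l₂ l₃ := by
  obtain ⟨L, -, -, hlast, harm⟩ := exists_label_vertex (l₂ := l₂) o hg hl₂ hl₃
  rcases a with _ | ⟨v, i⟩
  · have hc : (endCycle : (SumGadget.graph 3 l₃ g).ClosedWalk).IsCycle := by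
      refine ⟨by change 3 ≤ g; omega, fun j j' h => natCast_fin_injective ?_⟩
      have h1 := congrArg (fun x => L ((inclVertex o g l₂ l₃ (Classical.arbitrary V)).toFun x)) h
      have h2 := (hlast _ j.val).symm.trans (h1.trans (hlast _ j'.val))
      exact Label.star.inj h2
    exact ⟨atVertex (Classical.arbitrary V), endCycle, ⟨hc, Or.inr (Or.inl rfl)⟩, rfl⟩
  · have hc : (arm i.castSucc : (SumGadget.graph 3 l₃ g).ClosedWalk).IsCycle := by
      refine ⟨by change 3 ≤ g; omega, fun j j' h => natCast_fin_injective ?_⟩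
      have h1 := congrArg (fun x => L ((inclVertex o g l₂ l₃ v).toFun x)) h
      have h2 := (harm v _ (j.val : ZMod g)).symm.trans (h1.trans (harm v _ (j'.val : ZMod g)))
      exact (Label.arm.inj h2).2
    exact ⟨atVertex v, arm (s := 3) i.castSucc, ⟨hc, Or.inr (Or.inr ⟨_, rfl⟩)⟩, rfl⟩

/-! ## Bases -/

/-- The cycles `Z^*`, `A^v_0`, `A^v_1` with an NT-basis of the tree union form an NT-basis. -/
theorem isNTBasis_union [Nonempty V] (hg : 4 ≤ g) (hl₂ : 2 ≤ l₂) (hl₃ : 2 ≤ l₃)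
    {BT : Set (treeUnion o g l₂ l₃).ClosedWalk} (hBT : IsNTBasis BT) :
    IsNTBasis (Set.range (basisCycle o g l₂ l₃) ∪ treeCycles o g l₂ l₃ BT) := by
  have : NeZero g := ⟨by omega⟩
  constructor
  · obtain ⟨r, hr, hr'⟩ := exists_retraction (g := g) o l₂ l₃
    -- The retraction collapses each slice to a point, so `ρ` kills `basisCycle`; on walks of $T^*$
    -- it is the injective evaluation of the universal cocycle. Hence the span of the first family,
    -- inside $\ker\rho$, meets that of the second trivially.
    let ρ := ((treeUnion o g l₂ l₃).isCocycle_univCocycle.comp r).eval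
    have hρ0 : ∀ a, ρ (basisCycle o g l₂ l₃ a).cls = 0 := by
      have hself : ∀ x y : Vertex o g l₂ l₃, r.toFun x = r.toFun y →
          (treeUnion o g l₂ l₃).univCocycle (r.toFun x) (r.toFun y) = 0 := by
        intro x y h
        rw [h]
        exact (treeUnion o g l₂ l₃).isCocycle_univCocycle.self _
      intro a
      rw [IsCocycle.eval_cls]
      refine Finset.sum_eq_zero fun j _ => hself _ _ (Subtype.ext ?_)
      rcases a with _ | ⟨v, i⟩
      · exact (hr' (atVertex _) (endVertex j.val)).trans
          (hr' (atVertex _) (endVertex (j.val + 1))).symm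
      · exact (hr' (atVertex v) (armVertex (s := 3) i.castSucc (j.val : ZMod g))).trans
          (hr' (atVertex v) (armVertex (s := 3) i.castSucc ((j.val + 1 : ℕ) : ZMod g))).symm
    have hρT : ∀ c : (treeUnion o g l₂ l₃).ClosedWalk, ρ (c.map (treeIncl o g l₂ l₃)).cls =
        (treeUnion o g l₂ l₃).isCocycle_univCocycle.eval c.cls := by
      intro c
      rw [IsCocycle.eval_cls, IsCocycle.eval_cls, ClosedWalk.sum_map]
      refine c.sum_congr fun x y _ => ?_
      change (treeUnion o g l₂ l₃).univCocycle (r.toFun x.1) (r.toFun y.1) = _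
      rw [hr, hr]
    have hA : LinearIndepOn ℤ ClosedWalk.cls (Set.range (basisCycle o g l₂ l₃)) := by
      refine linearIndepOn_range_cls (linearIndependent_cls _ fun a => ?_)
      obtain ⟨f, hf, -, h1, h2⟩ := exists_separating_cocycle (l₂ := l₂) (l₃ := l₃) o hg hl₂ hl₃ a
      exact ⟨f, hf, h1, h2⟩
    have hT : LinearIndepOn ℤ (ρ ∘ ClosedWalk.cls) (treeCycles o g l₂ l₃ BT) := by
      refine LinearIndepOn.image_of_comp _ _ ?_
      have h1 : LinearIndepOn ℤ
          ((treeUnion o g l₂ l₃).isCocycle_univCocycle.eval ∘ ClosedWalk.cls) BT :=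
        LinearIndependent.map' hBT.1 _
          (LinearMap.ker_eq_bot.2 (eval_univCocycle_injective _))
      exact h1.congr fun c _ => (hρT c).symm
    refine LinearIndepOn.union hA (hT.of_comp _) ?_
    rw [Set.image_eq_range ClosedWalk.cls (treeCycles o g l₂ l₃ BT)]
    refine Disjoint.mono_left ?_ (Submodule.range_ker_disjoint hT).symm
    rw [Submodule.span_le]
    rintro _ ⟨_, ⟨a, rfl⟩, rfl⟩
    exact hρ0 a
  · refine span_cls_eq_top fun Q _ f hf h0 => ?_
    refine exists_potential_graph hf (fun a => h0 _ (Or.inl ⟨a, rfl⟩)) ?_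
    refine exists_potential_of_span hBT.2
      (treeUnion_connected (⟨_, star_mem_treeVerts⟩ : treeVerts o g l₂ l₃))
      (hf.comp (treeIncl o g l₂ l₃)) fun c hc => ?_
    exact h0 _ (Or.inr ⟨c, hc, rfl⟩)

/-- The cycles `Z^*`, `A^v_0`, `A^v_1` form an NT-basis of the graph in which an NT-basis of the
tree union is plugged. -/
theorem isNTBasis_plug [Nonempty V] (hg : 4 ≤ g) (hl₂ : 2 ≤ l₂) (hl₃ : 2 ≤ l₃)
    {BT : Set (treeUnion o g l₂ l₃).ClosedWalk} (hBT : IsNTBasis BT) :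
    IsNTBasis (ClosedWalk.map ((graph o g l₂ l₃).plugIncl (treeCycles o g l₂ l₃ BT)) ''
      Set.range (basisCycle o g l₂ l₃)) := by
  have : NeZero g := ⟨by omega⟩
  rw [← Set.range_comp]
  constructor
  · refine linearIndepOn_range_cls (linearIndependent_cls _ fun a => ?_)
    obtain ⟨f, hf, hfT, h1, h2⟩ := exists_separating_cocycle (l₂ := l₂) (l₃ := l₃) o hg hl₂ hl₃ a
    have hsupp : ∀ c ∈ treeCycles o g l₂ l₃ BT, ∀ x ∈ c.support, x ∈ treeVerts o g l₂ l₃ := by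
      rintro _ ⟨c, _, rfl⟩ _ ⟨i, rfl⟩
      exact (c.vert i).2
    exact ⟨_, hf.extend_plug fun c hc x hx y hy => hfT x (hsupp c hc x hx) y (hsupp c hc y hy),
      h1, h2⟩
  · refine span_cls_eq_top fun Q _ f hf h0 => exists_potential_plug hf ?_
    have hf' := hf.comp ((graph o g l₂ l₃).plugIncl (treeCycles o g l₂ l₃ BT))
    refine exists_potential_graph hf' (fun a => h0 _ ⟨a, rfl⟩) ?_
    refine exists_potential_of_span hBT.2
      (treeUnion_connected (⟨_, star_mem_treeVerts⟩ : treeVerts o g l₂ l₃))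
      (hf'.comp (treeIncl o g l₂ l₃)) fun c hc => ?_
    -- The cycles of `BT` need not be in the basis here: each is filled by its new vertex, so the
    -- cocycle vanishes on it automatically.
    exact hf.sum_plug ⟨c.map (treeIncl o g l₂ l₃), c, hc, rfl⟩

end Prelim

theorem theorem6p1 {V : Type*} [Finite V] [Nonempty V] (G : SimpleGraph V) (o : EdgeOrder G)
    (g l₂ l₃ : ℕ) (hg : 4 ≤ g) (hl₂ : 2 ≤ l₂) (hl₃ : 2 ≤ l₃) :
    (∃ BT : Set (Prelim.treeUnion o g l₂ l₃).ClosedWalk,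
      ReflGraph.IsNTBasis BT ∧ ∀ c ∈ BT, c.IsCycle) ∧
    ∀ BT : Set (Prelim.treeUnion o g l₂ l₃).ClosedWalk,
      ReflGraph.IsNTBasis BT → (∀ c ∈ BT, c.IsCycle) →
        (∃ A ⊆ Prelim.gadgetCycles o g l₂ l₃,
          ReflGraph.IsNTBasis (A ∪ Prelim.treeCycles o g l₂ l₃ BT)) ∧
        (∃ A ⊆ Prelim.endGadgetCycles o g l₂ l₃,
          ReflGraph.IsNTBasis (ReflGraph.ClosedWalk.map
            ((Prelim.graph o g l₂ l₃).plugIncl (Prelim.treeCycles o g l₂ l₃ BT)) '' A)) := by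
  have : NeZero g := ⟨by omega⟩
  constructor
  · have : Nonempty (Prelim.treeVerts o g l₂ l₃) := ⟨⟨_, Prelim.star_mem_treeVerts⟩⟩
    exact ReflGraph.exists_ntBasis_isCycle Prelim.treeUnion_connected
      (Prelim.treeUnion_triangle hg hl₂ hl₃)
  · intro BT hBT _
    refine ⟨⟨Set.range (Prelim.basisCycle o g l₂ l₃), ?_, Prelim.isNTBasis_union hg hl₂ hl₃ hBT⟩,
      ⟨Set.range (Prelim.basisCycle o g l₂ l₃), ?_, Prelim.isNTBasis_plug hg hl₂ hl₃ hBT⟩⟩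
    · rintro _ ⟨a, rfl⟩
      exact Prelim.basisCycle_mem_gadgetCycles hg hl₂ hl₃ a
    · rintro _ ⟨a, rfl⟩
      exact Prelim.basisCycle_mem_endGadgetCycles a
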